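/- **SINR distribution of D2D links in the shared network.** *Model.* Let $M\ge 0$ be an integer, $\lambda_{D_i}>0$, $p_{t_i},p_{f_i}\in[0,1]$, $b_{D_i}\ge 0$ for $1\le i\le M$, and $\lambda_B>0$, $\lambda_U\ge 0$, $b_C\ge 0$, $B>0$, $P_D,P_B>0$, $\sigma^2\ge 0$, $\delta>0$, $\alpha>2$. Potential D2D transmitters of type $i$ form a homogeneous Poisson point process (PPP) $\Phi_{D_i}$ on $\mathbb R^2$ with density $\lambda_{D_i}$, and base stations (BSs) form a homogeneous PPP $\Phi_B$ with density $\lambda_B$. Each D2D transmitter of type $i$ is active in the considered time slot with probability $p_{t_i}$ and accesses the considered subband with probability $p_{f_i}$; those which do both form the thinned process $\tilde\Phi_{D_i}$, and $\tilde\Phi_D=\bigcup_i\tilde\Phi_{D_i}$, which has density $\tilde\lambda_D=\sum_{i=1}^M p_{t_i}p_{f_i}\lambda_{D_i}$. Each BS transmits on the considered resource block with probability $$\rho^{(S)}=\min\Big\{\frac{b_C\lambda_U+\sum_{i=1}^M b_{D_i}(1-p_{t_i})\lambda_{D_i}}{\lambda_B B},\,1\Big\},$$ and the transmitting BSs form the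 thinned process $\tilde\Phi_B$. A typical active D2D link has its receiver at the origin and its transmitter at $X_0$, a centred Gaussian vector in $\mathbb R^2$ with covariance matrix $\delta^2 I$ (so that $|X_0|$ is Rayleigh distributed). The fading gains of the typical link ($h_0$), of the D2D interferers and of the BSs ($h_i$) are exponentially distributed with mean $1$. All point processes, all access and transmission decisions, all fading gains and $X_0$ are mutually independent. Put $$I_{\tilde\Phi_D}=\sum_{X_i\in\tilde\Phi_D\setminus X_0}P_Dh_i|X_i|^{-\alpha},\qquad I_{\tilde\Phi_B}=\sum_{B_i\in\tilde\Phi_B}P_Bh_i|B_i|^{-\alpha},\qquad \mathrm{SINR}_D=\frac{P_Dh_0|X_0|^{-\alpha}}{I_{\tilde\Phi_D}+I_{\tilde\Phi_B}+\sigma^2},$$ where $\mathrm{SINR}_D=\infty$ if the denominator vanishes and the numerator does not, and let $\mathcal L_I(s)=\mathbb E[e^{-sI}]$. *Theorem.* Let $\beta>0$. Then $I_{\tilde\Phi_D}$ and $I_{\tilde\Phi_B}$ are almost surely finite, and the coverage probability of the typical active D2D link is $$\mathbb P(\mathrm{SINR}_D>\beta)=\int_0^\infty e^{-s\sigma^2}\,\mathcal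 L_{I_{\tilde\Phi_D}}(s)\,\mathcal L_{I_{\tilde\Phi_B}}(s)\,\frac{v}{\delta^2}\exp\Big(-\frac{v^2}{2\delta^2}\Big)\,dv,\qquad s=\beta P_D^{-1}v^\alpha,$$ where the integrand is integrable. Moreover, for all $s\ge 0$, $$\mathcal L_{I_{\tilde\Phi_D}}(s)=\exp\Big(-\tilde\lambda_D\,\frac{2\pi^2/\alpha}{\sin(2\pi/\alpha)}\,(sP_D)^{2/\alpha}\Big),$$ and for all $v\ge 0$ and $s=\beta P_D^{-1}v^\alpha$, $$\mathcal L_{I_{\tilde\Phi_B}}(s)=\exp\big(-2\pi\rho^{(S)}\lambda_Bv^2H_0(\beta,\alpha)\big),\qquad H_0(\beta,\alpha)=\int_0^\infty\frac{x}{1+\beta^{-1}(P_D/P_B)\,x^\alpha}\,dx,$$ the last integral being convergent. -/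

import Mathlib

open MeasureTheory ProbabilityTheory
open scoped ENNReal NNReal

noncomputable section

/-- The Euclidean plane in which all nodes are deployed. -/
abbrev Plane : Type := EuclideanSpace ℝ (Fin 2)

/-- Number of points of the enumerated point process `X` that lie in the set `A`. -/
def pointCount {Ω : Type*} (X : ℕ → Ω → Plane) (A : Set Plane) (ω : Ω) : ℝ≥0∞ :=
  ∑' n, A.indicator (fun _ => 1) (X n ω)

/-- `X 0, X 1, X 2, …` is a measurable enumeration of the points of a homogeneous Poisson point
process on the plane with density `lam > 0`: the number of points in a bounded Borel set `A` is
Poisson distributed with mean `lam * |A|`, and the numbers of points in disjoint bounded Borel sets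
are independent. (For `lam > 0` the process has infinitely many points, so that its points can be
enumerated by `ℕ`.) -/
structure IsHomogeneousPPP {Ω : Type*} [MeasurableSpace Ω] (X : ℕ → Ω → Plane) (lam : ℝ)
    (P : Measure Ω) : Prop where
  measurable : ∀ n, Measurable (X n)
  count_law : ∀ A : Set Plane, MeasurableSet A → Bornology.IsBounded A →
    HasLaw (pointCount X A)
      ((poissonMeasure (lam.toNNReal * (volume A).toNNReal)).map (Nat.cast : ℕ → ℝ≥0∞)) P
  count_indep : ∀ (k : ℕ) (A : Fin k → Set Plane), (∀ j, MeasurableSet (A j)) →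
    (∀ j, Bornology.IsBounded (A j)) → Pairwise (fun i j => Disjoint (A i) (A j)) →
    iIndepFun (fun j => pointCount X (A j)) P

/-- Parameters of a D2D-enabled cellular network with `M` types of potential D2D links. -/
structure NetworkParams (M : ℕ) where
  /-- density of the potential D2D links of type `i` -/
  lamD : Fin M → ℝ
  /-- density of the base stations -/
  lamB : ℝ
  /-- density of the cellular users -/
  lamU : ℝ
  /-- time hopping probability of type `i` -/
  pt : Fin M → ℝ
  /-- frequency hopping probability of type `i` -/
  pf : Fin M → ℝ
  /-- scale of the Gaussian displacement between a D2D transmitter and its receiver -/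
  δ : ℝ
  /-- total number of subbands -/
  B : ℝ
  /-- resource requirement of a cellular user -/
  bC : ℝ
  /-- resource requirement of a D2D link of type `i` -/
  bD : Fin M → ℝ
  /-- transmission power of the D2D transmitters -/
  PD : ℝ
  /-- transmission power of the base stations -/
  PB : ℝ
  /-- noise power `σ²` -/
  noise : ℝ
  /-- path loss exponent -/
  α : ℝ

namespace NetworkParams

variable {M : ℕ}

/-- The admissible range of the parameters. -/
structure Valid (p : NetworkParams M) : Prop where
  lamD_pos : ∀ i, 0 < p.lamD i
  lamB_pos : 0 < p.lamB
  lamU_nonneg : 0 ≤ p.lamU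
  pt_mem : ∀ i, p.pt i ∈ Set.Icc (0 : ℝ) 1
  pf_mem : ∀ i, p.pf i ∈ Set.Icc (0 : ℝ) 1
  δ_pos : 0 < p.δ
  B_pos : 0 < p.B
  bC_nonneg : 0 ≤ p.bC
  bD_nonneg : ∀ i, 0 ≤ p.bD i
  PD_pos : 0 < p.PD
  PB_pos : 0 < p.PB
  noise_nonneg : 0 ≤ p.noise
  two_lt_α : 2 < p.α

/-- Density `∑ p_t p_f λ` of the interfering D2D transmitters. -/
def lamDTilde (p : NetworkParams M) : ℝ := ∑ i, p.pt i * p.pf i * p.lamD i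

/-- Fraction `ρ` of normal resource blocks in the shared network, i.e. of the resource blocks on
which a base station transmits. -/
def rhoS (p : NetworkParams M) : ℝ :=
  min ((p.bC * p.lamU + ∑ i, p.bD i * (1 - p.pt i) * p.lamD i) / (p.lamB * p.B)) 1

/-- `H₀(β, α) = ∫₀^∞ x / (1 + β⁻¹ (P_D / P_B) x^α) dx`. -/
def H0 (p : NetworkParams M) (β : ℝ) : ℝ :=
  ∫ x in Set.Ioi (0 : ℝ), x / (1 + β⁻¹ * (p.PD / p.PB) * x ^ p.α)

end NetworkParams

/-- Labels of the independent sources of randomness in the network. -/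
inductive RandomSource (M : ℕ) : Type
  | typicalPos : RandomSource M
  | typicalFading : RandomSource M
  | posD : Fin M → RandomSource M
  | timeD : Fin M → ℕ → RandomSource M
  | freqD : Fin M → ℕ → RandomSource M
  | fadingD : Fin M → ℕ → RandomSource M
  | posB : RandomSource M
  | onB : ℕ → RandomSource M
  | fadingB : ℕ → RandomSource M

/-- The random elements of the shared network, seen from a typical active D2D link whose receiver
is located at the origin. -/
structure SharedNetwork (M : ℕ) (Ω : Type*) where
  /-- location of the transmitter of the typical link -/
  X0 : Ω → Plane
  /-- fading coefficient of the typical link -/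
  h0 : Ω → ℝ
  /-- `XD i n`: location of the `n`-th potential D2D transmitter of type `i` -/
  XD : Fin M → ℕ → Ω → Plane
  /-- whether this transmitter is in D2D mode in the slot considered -/
  timeD : Fin M → ℕ → Ω → Bool
  /-- whether this link accesses the subband considered -/
  freqD : Fin M → ℕ → Ω → Bool
  /-- fading coefficient from this transmitter to the origin -/
  hD : Fin M → ℕ → Ω → ℝ
  /-- `XB n`: location of the `n`-th base station -/
  XB : ℕ → Ω → Plane
  /-- whether this base station transmits on the resource block considered -/
  onB : ℕ → Ω → Bool
  /-- fading coefficient from this base station to the origin -/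
  hB : ℕ → Ω → ℝ

namespace SharedNetwork

variable {M : ℕ} {Ω : Type*}

/-- The σ-algebra generated by each source of randomness; the locations of a whole point process
form one source. -/
def sourceSigma (S : SharedNetwork M Ω) : RandomSource M → MeasurableSpace Ω
  | .typicalPos => MeasurableSpace.comap S.X0 inferInstance
  | .typicalFading => MeasurableSpace.comap S.h0 inferInstance
  | .posD i => ⨆ n, MeasurableSpace.comap (S.XD i n) inferInstance
  | .timeD i n => MeasurableSpace.comap (S.timeD i n) inferInstance
  | .freqD i n => MeasurableSpace.comap (S.freqD i n) inferInstance
  | .fadingD i n => MeasurableSpace.comap (S.hD i n) inferInstance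
  | .posB => ⨆ n, MeasurableSpace.comap (S.XB n) inferInstance
  | .onB n => MeasurableSpace.comap (S.onB n) inferInstance
  | .fadingB n => MeasurableSpace.comap (S.hB n) inferInstance

/-- The probabilistic model: Poisson deployment, Gaussian displacement of the typical pair,
independent time-frequency hopping of the D2D links, independent thinning of the base stations with
retention probability `ρ`, independent Rayleigh fading (power gains exponential with mean one). -/
structure IsModel [MeasurableSpace Ω] (S : SharedNetwork M Ω) (p : NetworkParams M)
    (P : Measure Ω) : Prop where
  X0_measurable : Measurable S.X0
  X0_law : P.map S.X0 = (stdGaussian Plane).map (fun x => p.δ • x)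
  h0_measurable : Measurable S.h0
  h0_law : P.map S.h0 = expMeasure 1
  XD_ppp : ∀ i, IsHomogeneousPPP (S.XD i) (p.lamD i) P
  timeD_measurable : ∀ i n, Measurable (S.timeD i n)
  timeD_law : ∀ i n, P {ω | S.timeD i n ω = true} = ENNReal.ofReal (p.pt i)
  freqD_measurable : ∀ i n, Measurable (S.freqD i n)
  freqD_law : ∀ i n, P {ω | S.freqD i n ω = true} = ENNReal.ofReal (p.pf i)
  hD_measurable : ∀ i n, Measurable (S.hD i n)
  hD_law : ∀ i n, P.map (S.hD i n) = expMeasure 1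
  XB_ppp : IsHomogeneousPPP S.XB p.lamB P
  onB_measurable : ∀ n, Measurable (S.onB n)
  onB_law : ∀ n, P {ω | S.onB n ω = true} = ENNReal.ofReal p.rhoS
  hB_measurable : ∀ n, Measurable (S.hB n)
  hB_law : ∀ n, P.map (S.hB n) = expMeasure 1
  indep : iIndep S.sourceSigma P

/-- Power received at the origin from a transmitter at `x` with power `pow`, fading `h` and path
loss `|x|^(-α)`. -/
def receivedPower (α pow h : ℝ) (x : Plane) : ℝ≥0∞ :=
  ENNReal.ofReal (pow * h) * ENNReal.ofReal ‖x‖ ^ (-α)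

/-- Indices of the interfering D2D transmitters of type `i`: those in D2D mode which access the
subband considered, other than the typical transmitter. -/
def interferersD (S : SharedNetwork M Ω) (i : Fin M) (ω : Ω) : Set ℕ :=
  {n | S.timeD i n ω = true ∧ S.freqD i n ω = true ∧ S.XD i n ω ≠ S.X0 ω}

/-- Indices of the interfering base stations. -/
def interferersB (S : SharedNetwork M Ω) (ω : Ω) : Set ℕ := {n | S.onB n ω = true}

/-- Interference from the other D2D links. -/
def interferenceD (S : SharedNetwork M Ω) (p : NetworkParams M) (ω : Ω) : ℝ≥0∞ :=
  ∑ i, ∑' n, (S.interferersD i ω).indicator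
    (fun n => receivedPower p.α p.PD (S.hD i n ω) (S.XD i n ω)) n

/-- Interference from the base stations. -/
def interferenceB (S : SharedNetwork M Ω) (p : NetworkParams M) (ω : Ω) : ℝ≥0∞ :=
  ∑' n, (S.interferersB ω).indicator
    (fun n => receivedPower p.α p.PB (S.hB n ω) (S.XB n ω)) n

/-- SINR of the typical active D2D link; it is `∞` if a positive signal meets neither interference
nor noise. -/
def sinrD (S : SharedNetwork M Ω) (p : NetworkParams M) (ω : Ω) : ℝ≥0∞ :=
  receivedPower p.α p.PD (S.h0 ω) (S.X0 ω) /
    (S.interferenceD p ω + S.interferenceB p ω + ENNReal.ofReal p.noise)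

/-- Coverage probability `ℙ(SINR_D > β)` of the typical active D2D link. -/
def coverageD [MeasurableSpace Ω] (S : SharedNetwork M Ω) (p : NetworkParams M) (P : Measure Ω)
    (β : ℝ) : ℝ :=
  P.real {ω | ENNReal.ofReal β < S.sinrD p ω}

end SharedNetwork

/-- Laplace transform `s ↦ 𝔼[exp (-s I)]` of an almost surely finite random variable `I ≥ 0`. -/
def laplaceTransform {Ω : Type*} [MeasurableSpace Ω] (P : Measure Ω) (I : Ω → ℝ≥0∞) (s : ℝ) : ℝ :=
  ∫ ω, Real.exp (-s * (I ω).toReal) ∂P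

/-- Density `v / δ² * exp (-v² / (2 δ²))` of the Rayleigh distribution. -/
def rayleighDensity (δ v : ℝ) : ℝ := v / δ ^ 2 * Real.exp (-v ^ 2 / (2 * δ ^ 2))

end

noncomputable section

open Filter Topology Finset

/-! Rayleigh fading makes coverage a Laplace transform. Almost surely, the SINR exceeds `β` exactly
when `h0 > s (I_D + I_B + σ²)` with `s = β P_D⁻¹ |X0|^α`. Since `h0` is exponential and independent
of the rest, the probability is `𝔼 exp (-s (I_D + I_B + σ²))` (`measure_lt_sinrD`). Integrating out
`X0`, whose norm is Rayleigh, and factorising over the independent interferences gives the integral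
over `v`.

The transforms come from the Laplace functional `𝔼 exp (-∑ φ) = exp (-λ ∫ (1 - g))` of an
independently marked Poisson process, where `g x` is the mean of `exp (-φ)` over the mark of a point
at `x`. It is built from counts: simple functions with bounded support, then monotone limits
(`lintegral_negExp`), then averaging over the marks (`lintegral_negExp_marked`). On/off decisions
and fading are the marks, so no thinned process has to be constructed. Here `1 - g` is `ρ / (1 + (t
pow)⁻¹ r^α)` at radius `r`; polar coordinates and Euler's reflection formula evaluate its integral.

The computation takes place in `[0, ∞]` with `exp (-∞) = 0`, so no finiteness of the interference is
presupposed. It follows afterwards, because the transforms tend to `1` as `t ↓ 0`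
(`ae_lt_top_of_lintegral_negExp`). -/

/-! ### The function `exp (-x)` on `[0, ∞]` -/

/-- The function `x ↦ exp (-x)` on `[0, ∞]`, with `exp (-∞) = 0`. -/
def negExp (x : ℝ≥0∞) : ℝ≥0∞ := EReal.exp (-(x : EReal))

/-- The function `q ↦ -log q` on `[0, 1]`, extended by `0`. -/
def negLog (q : ℝ≥0∞) : ℝ≥0∞ := (-ENNReal.log q).toENNReal

lemma negExp_zero : negExp 0 = 1 := by simp [negExp]

lemma negExp_top : negExp ∞ = 0 := by simp [negExp]

lemma negExp_ofReal {x : ℝ} (hx : 0 ≤ x) :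
    negExp (ENNReal.ofReal x) = ENNReal.ofReal (Real.exp (-x)) := by
  rw [negExp, EReal.coe_ennreal_ofReal, max_eq_left hx, ← EReal.coe_neg, EReal.exp_coe]

lemma negExp_eq_ofReal {x : ℝ≥0∞} (hx : x ≠ ∞) :
    negExp x = ENNReal.ofReal (Real.exp (-x.toReal)) := by
  conv_lhs => rw [← ENNReal.ofReal_toReal hx]
  exact negExp_ofReal ENNReal.toReal_nonneg

lemma negExp_add (x y : ℝ≥0∞) : negExp (x + y) = negExp x * negExp y := by
  rw [negExp, negExp, negExp, EReal.coe_ennreal_add, ← EReal.exp_add]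
  congr 1
  rw [EReal.neg_add (Or.inl (by simp)) (Or.inr (by simp)), sub_eq_add_neg]

lemma negExp_sum {ι : Type*} (s : Finset ι) (f : ι → ℝ≥0∞) :
    negExp (∑ i ∈ s, f i) = ∏ i ∈ s, negExp (f i) := by
  classical
  induction s using Finset.induction_on with
  | empty => simp [negExp_zero]
  | insert a s ha ih => rw [sum_insert ha, prod_insert ha, negExp_add, ih]

lemma negExp_mul_natCast (a : ℝ≥0∞) (n : ℕ) : negExp (a * n) = negExp a ^ n := by
  have := negExp_sum (range n) (fun _ => a)
  simpa [mul_comm] using this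

lemma antitone_negExp : Antitone negExp := fun x y h => by
  rw [negExp, negExp, EReal.exp_le_exp_iff, EReal.neg_le_neg_iff]
  exact_mod_cast h

lemma negExp_le_one (x : ℝ≥0∞) : negExp x ≤ 1 :=
  negExp_zero ▸ antitone_negExp zero_le

lemma negExp_ne_top (x : ℝ≥0∞) : negExp x ≠ ∞ := ne_top_of_le_ne_top ENNReal.one_ne_top (negExp_le_one x)

lemma continuous_negExp : Continuous negExp :=
  ENNReal.continuous_exp.comp (continuous_neg.comp continuous_coe_ennreal_ereal)

@[fun_prop]
lemma measurable_negExp : Measurable negExp := continuous_negExp.measurable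

lemma measurable_negLog : Measurable negLog := by
  unfold negLog
  exact (ENNReal.measurable_log.neg).ereal_toENNReal

lemma negExp_negLog {q : ℝ≥0∞} (hq : q ≤ 1) : negExp (negLog q) = q := by
  have h : 0 ≤ -ENNReal.log q := by
    rw [EReal.le_neg, neg_zero]; simpa using hq
  rw [negExp, negLog, EReal.coe_toENNReal h, neg_neg, ENNReal.exp_log]

lemma tendsto_prod_negExp (f : ℕ → ℝ≥0∞) :
    Tendsto (fun N => ∏ n ∈ range N, negExp (f n)) atTop (𝓝 (negExp (∑' n, f n))) := by
  simp_rw [← negExp_sum]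
  exact (continuous_negExp.tendsto _).comp (ENNReal.tendsto_nat_tsum f)

/-! ### Grouping independent σ-algebras -/

/-- Induction on the finite set of groups: a new group is independent of the σ-algebra generated by
the union of the earlier ones, which contains the intersection of their events. -/
lemma iIndep_iSup_of_pairwise_disjoint {Ω ι κ : Type*} {m : ι → MeasurableSpace Ω}
    {mΩ : MeasurableSpace Ω} {P : Measure Ω} [IsProbabilityMeasure P]
    (hle : ∀ i, m i ≤ mΩ) (h : iIndep m P)
    (T : κ → Set ι) (hT : Pairwise (fun j k => Disjoint (T j) (T k))) :
    iIndep (fun j => ⨆ i ∈ T j, m i) P := by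
  classical
  rw [iIndep_iff]
  intro s f
  induction s using Finset.induction_on with
  | empty => simp
  | insert a s ha ih =>
    intro hf
    rw [prod_insert ha, ← ih (fun i hi => hf i (mem_insert_of_mem hi)), set_biInter_insert]
    have hd : Disjoint (T a) (⋃ j ∈ s, T j) := by
      rw [Set.disjoint_iUnion₂_right]
      exact fun j hj => hT (by rintro rfl; exact ha hj)
    refine (Indep_iff _ _ P).1 (indep_iSup_of_disjoint hle h hd) _ _
      (hf a (mem_insert_self a s)) ?_
    refine Finset.measurableSet_biInter _ fun j hj => ?_
    have : (⨆ i ∈ T j, m i) ≤ ⨆ i ∈ ⋃ j ∈ s, T j, m i :=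
      biSup_mono fun i hi => Set.mem_iUnion₂.2 ⟨j, hj, hi⟩
    exact this _ (hf j (mem_insert_of_mem hj))

/-- The joint law is a product, so Tonelli applies. This plays the role of conditioning on `X`
throughout: `X` is frozen and only `Y` is averaged. -/
lemma IndepFun.lintegral_comp_prodMk {Ω E F : Type*} [MeasurableSpace Ω] [MeasurableSpace E]
    [MeasurableSpace F] {P : Measure Ω} [IsProbabilityMeasure P] {X : Ω → E} {Y : Ω → F}
    (hX : Measurable X) (hY : Measurable Y) (h : IndepFun X Y P) {f : E × F → ℝ≥0∞}
    (hf : Measurable f) :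
    ∫⁻ ω, f (X ω, Y ω) ∂P = ∫⁻ ω, ∫⁻ ω', f (X ω, Y ω') ∂P ∂P := by
  have := (indepFun_iff_map_prod_eq_prod_map_map hX.aemeasurable hY.aemeasurable).1 h
  have : IsProbabilityMeasure (P.map X) := Measure.isProbabilityMeasure_map hX.aemeasurable
  have : IsProbabilityMeasure (P.map Y) := Measure.isProbabilityMeasure_map hY.aemeasurable
  rw [← lintegral_map (g := fun ω => (X ω, Y ω)) hf (hX.prodMk hY), ‹Measure.map _ _ = _›,
    lintegral_prod _ hf.aemeasurable, lintegral_map hf.lintegral_prod_right' hX]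
  refine lintegral_congr fun ω => ?_
  rw [lintegral_map (by fun_prop) hY]

/-! ### Laplace functional of a Poisson point process -/

/-- This is the generating function `𝔼 t^N = exp (-r (1 - t))` at `t = exp (-a)`; `a = ∞` is the
case `t = 0`. -/
lemma lintegral_negExp_poissonMeasure (r : ℝ≥0) (a : ℝ≥0∞) :
    ∫⁻ n : ℕ, negExp (a * n) ∂(poissonMeasure r) = negExp (r * (1 - negExp a)) := by
  obtain ⟨t, ht⟩ : ∃ t : ℝ≥0, (t : ℝ≥0∞) = negExp a :=
    ⟨_, ENNReal.coe_toNNReal (negExp_ne_top a)⟩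
  have ht1 : t ≤ 1 := by
    have := negExp_le_one a
    rw [← ht] at this
    exact_mod_cast this
  have hR : (r : ℝ≥0∞) * (1 - negExp a) = ENNReal.ofReal (r * (1 - t)) := by
    rw [← ht, ENNReal.ofReal_mul (by positivity), ENNReal.ofReal_coe_nnreal, ENNReal.ofReal_sub _ t.coe_nonneg]
    simp
  have hs : HasSum (fun n : ℕ => Real.exp (-r) * (r * t : ℝ) ^ n / n.factorial)
      (Real.exp (-(r * (1 - t)))) := by
    have := (NormedSpace.expSeries_div_hasSum_exp (r * t : ℝ)).mul_left (Real.exp (-r))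
    rw [← Real.exp_eq_exp_ℝ, ← Real.exp_add] at this
    rw [show -(r * (1 - t) : ℝ) = -r + r * t by ring]
    simpa only [mul_div_assoc] using this
  rw [hR, negExp_ofReal (mul_nonneg r.coe_nonneg (sub_nonneg.2 (by exact_mod_cast ht1))), ← hs.tsum_eq,
    ENNReal.ofReal_tsum_of_nonneg (fun n => by positivity) hs.summable, lintegral_countable']
  refine tsum_congr fun n => ?_
  rw [negExp_mul_natCast, ← ht, poissonMeasure_singleton, ← ENNReal.ofReal_coe_nnreal,
    ← ENNReal.ofReal_pow t.coe_nonneg, ← ENNReal.ofReal_mul (by positivity)]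
  congr 1
  rw [mul_pow]; ring

namespace IsHomogeneousPPP

variable {Ω : Type*} {X : ℕ → Ω → Plane} {lam : ℝ}

/-- The points are grouped by the value of `f`. The value `0` is dropped because its level set may
be unbounded, and count laws are available only for bounded sets. -/
lemma tsum_simpleFunc_eq (X : ℕ → Ω → Plane) (f : SimpleFunc Plane ℝ≥0∞) (ω : Ω) :
    ∑' n, f (X n ω) = ∑ c ∈ f.range.filter (· ≠ 0), c * pointCount X (f ⁻¹' {c}) ω := by
  have h : ∀ n, f (X n ω) = ∑ c ∈ f.range.filter (· ≠ 0),
      c * (f ⁻¹' {c}).indicator (fun _ => 1) (X n ω) := by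
    intro n
    by_cases h0 : f (X n ω) = 0
    · rw [h0, eq_comm]
      refine sum_eq_zero fun c hc => ?_
      rw [Set.indicator_of_notMem, mul_zero]
      simp only [Set.mem_preimage, Set.mem_singleton_iff, h0]
      exact fun h => (mem_filter.1 hc).2 h.symm
    · rw [sum_eq_single (f (X n ω))]
      · simp
      · intro c _ hc
        rw [Set.indicator_of_notMem, mul_zero]
        exact fun h => hc h.symm
      · intro h
        exact absurd (mem_filter.2 ⟨f.mem_range_self _, h0⟩) h
  simp_rw [h, pointCount, ← ENNReal.tsum_mul_left]
  exact Summable.tsum_finsetSum fun _ _ => ENNReal.summable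

variable [MeasurableSpace Ω] {P : Measure Ω}

lemma measurable_pointCount (hX : IsHomogeneousPPP X lam P) {A : Set Plane}
    (hA : MeasurableSet A) : Measurable (pointCount X A) :=
  Measurable.tsum fun n => (measurable_const.indicator hA).comp (hX.measurable n)

lemma lintegral_negExp_pointCount (hX : IsHomogeneousPPP X lam P) {A : Set Plane}
    (hA : MeasurableSet A) (hb : Bornology.IsBounded A) (a : ℝ≥0∞) :
    ∫⁻ ω, negExp (a * pointCount X A ω) ∂P =
      negExp (ENNReal.ofReal lam * ((1 - negExp a) * volume A)) := by
  rw [(hX.count_law A hA hb).lintegral_comp (f := fun x => negExp (a * x))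
    (measurable_negExp.comp (measurable_const.mul measurable_id)).aemeasurable,
    lintegral_map (f := fun x => negExp (a * x))
      (measurable_negExp.comp (measurable_const.mul measurable_id))
      (measurable_of_countable _), lintegral_negExp_poissonMeasure]
  congr 1
  rw [ENNReal.coe_mul, ENNReal.coe_toNNReal hb.measure_lt_top.ne, mul_assoc,
    mul_comm (volume A)]
  rfl

/-- The nonzero level sets are bounded and disjoint, so their counts are independent Poisson
variables and the expectation factorises into generating functions. -/
lemma lintegral_negExp_simpleFunc (hX : IsHomogeneousPPP X lam P) (f : SimpleFunc Plane ℝ≥0∞)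
    (hb : Bornology.IsBounded (Function.support f)) :
    ∫⁻ ω, negExp (∑' n, f (X n ω)) ∂P =
      negExp (ENNReal.ofReal lam * ∫⁻ x, (1 - negExp (f x))) := by
  set s := f.range.filter (· ≠ 0) with hs
  have hbd : ∀ c ∈ s, Bornology.IsBounded (f ⁻¹' {c}) := fun c hc => hb.subset fun x hx => by
    simp only [Set.mem_preimage, Set.mem_singleton_iff] at hx
    simpa [hx] using (mem_filter.1 hc).2
  have hR : ∫⁻ x, (1 - negExp (f x)) = ∑ c ∈ s, (1 - negExp c) * volume (f ⁻¹' {c}) := by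
    rw [show ∫⁻ x, (1 - negExp (f x)) = ∫⁻ x, (f.map (fun c => 1 - negExp c)) x from rfl,
      SimpleFunc.lintegral_eq_lintegral, SimpleFunc.map_lintegral, hs]
    rw [sum_filter_of_ne]
    rintro c _ hc rfl
    exact hc (by rw [negExp_zero, tsub_self, zero_mul])
  have hind : iIndepFun (fun j : Fin s.card => pointCount X (f ⁻¹' {(s.equivFin.symm j : ℝ≥0∞)})) P := by
    refine hX.count_indep _ _ (fun j => f.measurableSet_preimage _)
      (fun j => hbd _ (s.equivFin.symm j).2) fun i j hij => ?_
    refine Disjoint.preimage _ (Set.disjoint_singleton.2 fun h => hij ?_)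
    exact s.equivFin.symm.injective (Subtype.ext h)
  have hm : ∀ c : ℝ≥0∞, Measurable fun q : ℝ≥0∞ => negExp (c * q) := fun c =>
    measurable_negExp.comp (measurable_const.mul measurable_id)
  have hprod : ∀ g : ℝ≥0∞ → ℝ≥0∞,
      ∏ c ∈ s, g c = ∏ j : Fin s.card, g (s.equivFin.symm j) := fun g => by
    rw [← prod_coe_sort, ← Equiv.prod_comp s.equivFin.symm]
  simp_rw [tsum_simpleFunc_eq, ← hs, negExp_sum, hprod]
  refine (lintegral_prod_eq_prod_lintegral_of_indepFun univ _
    (hind.comp (fun j c => negExp ((s.equivFin.symm j : ℝ≥0∞) * c)) fun j => hm _)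
    (fun j => (hm _).comp
      (hX.measurable_pointCount (f.measurableSet_preimage _)))).trans ?_
  rw [hR, Finset.mul_sum, negExp_sum, hprod]
  refine prod_congr rfl fun j _ => ?_
  exact hX.lintegral_negExp_pointCount (f.measurableSet_preimage _)
    (hbd _ (s.equivFin.symm j).2) _

variable [IsProbabilityMeasure P]

/-- Simple functions cut off to growing balls increase to `f`. The left side passes to the limit by
domination by `1`, the right side by monotone convergence. -/
theorem lintegral_negExp (hX : IsHomogeneousPPP X lam P) {f : Plane → ℝ≥0∞} (hf : Measurable f) :
    ∫⁻ ω, negExp (∑' n, f (X n ω)) ∂P =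
      negExp (ENNReal.ofReal lam * ∫⁻ x, (1 - negExp (f x))) := by
  let g : ℕ → SimpleFunc Plane ℝ≥0∞ := fun k => (SimpleFunc.eapprox f k).restrict (Metric.ball 0 k)
  have hg : ∀ k x, g k x = (Metric.ball (0 : Plane) k).indicator (SimpleFunc.eapprox f k) x :=
    fun k x => SimpleFunc.restrict_apply _ measurableSet_ball x
  have hmono : ∀ x, Monotone fun k => g k x := fun x k l hkl => by
    simp only [hg]
    exact (Set.indicator_le_indicator (SimpleFunc.monotone_eapprox f hkl x)).trans
      (Set.indicator_le_indicator_of_subset (Metric.ball_subset_ball (by exact_mod_cast hkl))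
        (fun _ => zero_le) x)
  have hlim : ∀ x, Tendsto (fun k => g k x) atTop (𝓝 (f x)) := fun x => by
    have h1 : Tendsto (fun k => SimpleFunc.eapprox f k x) atTop (𝓝 (f x)) := by
      rw [← SimpleFunc.iSup_eapprox_apply hf x]
      exact tendsto_atTop_iSup fun k l hkl => SimpleFunc.monotone_eapprox f hkl x
    refine h1.congr' ?_
    obtain ⟨N, hN⟩ := exists_nat_gt ‖x‖
    filter_upwards [eventually_ge_atTop N] with k hk
    rw [hg, Set.indicator_of_mem]
    rw [mem_ball_zero_iff]
    exact hN.trans_le (by exact_mod_cast hk)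
  have hk := fun k => hX.lintegral_negExp_simpleFunc (g k) <|
    (Metric.isBounded_ball (x := (0 : Plane)) (r := k)).subset fun x hx => by
      by_contra h
      exact hx (by rw [hg, Set.indicator_of_notMem h])
  have hL : Tendsto (fun k => ∫⁻ ω, negExp (∑' n, g k (X n ω)) ∂P) atTop
      (𝓝 (∫⁻ ω, negExp (∑' n, f (X n ω)) ∂P)) := by
    refine tendsto_lintegral_of_dominated_convergence (fun _ => 1) (fun k => ?_)
      (fun k => Eventually.of_forall fun ω => negExp_le_one _) (by simp)
      (Eventually.of_forall fun ω => ?_)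
    · exact measurable_negExp.comp
        (Measurable.tsum fun n => (g k).measurable.comp (hX.measurable n))
    · refine (continuous_negExp.tendsto _).comp ?_
      -- The sum over points is an integral against counting measure, so monotone convergence
      -- handles it.
      simp_rw [← lintegral_count]
      exact lintegral_tendsto_of_tendsto_of_monotone
        (fun k => (measurable_of_countable _).aemeasurable)
        (Eventually.of_forall fun n => hmono _) (Eventually.of_forall fun n => hlim _)
  have hR : Tendsto (fun k => negExp (ENNReal.ofReal lam * ∫⁻ x, (1 - negExp (g k x)))) atTop
      (𝓝 (negExp (ENNReal.ofReal lam * ∫⁻ x, (1 - negExp (f x))))) := by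
    refine (continuous_negExp.tendsto _).comp (ENNReal.Tendsto.const_mul ?_ (Or.inr (by simp)))
    refine lintegral_tendsto_of_tendsto_of_monotone
      (fun k => (measurable_const.sub (measurable_negExp.comp (g k).measurable)).aemeasurable)
      (Eventually.of_forall fun x k l hkl => tsub_le_tsub_left (antitone_negExp (hmono x hkl)) _)
      (Eventually.of_forall fun x => ?_)
    exact ENNReal.Tendsto.sub tendsto_const_nhds ((continuous_negExp.tendsto _).comp (hlim x))
      (Or.inl (by simp))
  exact tendsto_nhds_unique hL ((tendsto_congr hk).2 hR)

/-- Laplace functional of an independently marked Poisson point process. -/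
theorem lintegral_negExp_marked {E : Type*} [MeasurableSpace E] (hX : IsHomogeneousPPP X lam P)
    {m : ℕ → Ω → E} (hm : ∀ n, Measurable (m n)) (hmi : iIndepFun m P)
    (hXm : IndepFun (fun ω n => X n ω) (fun ω n => m n ω) P) {φ : Plane × E → ℝ≥0∞}
    (hφ : Measurable φ) {g : Plane → ℝ≥0∞}
    (hφg : ∀ n x, ∫⁻ ω, negExp (φ (x, m n ω)) ∂P = g x) :
    ∫⁻ ω, negExp (∑' n, φ (X n ω, m n ω)) ∂P =
      negExp (ENNReal.ofReal lam * ∫⁻ x, (1 - g x)) := by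
  have hφ' : Measurable fun z => negExp (φ z) := measurable_negExp.comp hφ
  have hg : Measurable g := by
    have : g = fun x => ∫⁻ ω, negExp (φ (x, m 0 ω)) ∂P := funext fun x => (hφg 0 x).symm
    rw [this]
    exact Measurable.lintegral_prod_right' (f := fun z : Plane × Ω => negExp (φ (z.1, m 0 z.2)))
      (hφ'.comp (measurable_fst.prodMk ((hm 0).comp measurable_snd)))
  have hg1 : ∀ x, g x ≤ 1 := fun x => by
    rw [← hφg 0 x]
    exact (lintegral_mono fun e => negExp_le_one _).trans (by simp)
  -- With all positions frozen, the first `N` marks are independent and each factor averages to `g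
  -- (X n ω)`. Finite products avoid infinite products of expectations.
  have hN : ∀ N, ∫⁻ ω, ∏ n ∈ range N, negExp (φ (X n ω, m n ω)) ∂P =
      ∫⁻ ω, ∏ n ∈ range N, g (X n ω) ∂P := by
    intro N
    have h1 := IndepFun.lintegral_comp_prodMk (measurable_pi_lambda _ fun n => hX.measurable n)
      (measurable_pi_lambda _ fun n => hm n) hXm
      (f := fun z => ∏ n ∈ range N, negExp (φ (z.1 n, z.2 n)))
      (Finset.measurable_fun_prod _ fun n _ => hφ'.comp (by fun_prop))
    refine h1.trans (lintegral_congr fun ω => ?_)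
    have hmeas : ∀ n, Measurable fun e : E => negExp (φ (X n ω, e)) := fun n =>
      hφ'.comp (by fun_prop)
    have := lintegral_prod_eq_prod_lintegral_of_indepFun (range N) _
      (hmi.comp (fun n e => negExp (φ (X n ω, e))) hmeas) (fun n => (hmeas n).comp (hm n))
    exact this.trans (prod_congr rfl fun n _ => hφg n _)
  have hlog : ∀ x, negExp (negLog (g x)) = g x := fun x => negExp_negLog (hg1 x)
  -- Applied to `-log g`, the unmarked functional computes the mean of `∏ g (X n)`. Points with `g =
  -- 0` are allowed, as `-log 0 = ∞`.
  have key := hX.lintegral_negExp (measurable_negLog.comp hg)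
  simp only [Function.comp_apply, hlog] at key
  rw [← key]
  have hL : Tendsto (fun N => ∫⁻ ω, ∏ n ∈ range N, negExp (φ (X n ω, m n ω)) ∂P) atTop
      (𝓝 (∫⁻ ω, negExp (∑' n, φ (X n ω, m n ω)) ∂P)) := by
    refine tendsto_lintegral_of_dominated_convergence (fun _ => 1) (fun k => ?_)
      (fun k => Eventually.of_forall fun ω => prod_le_one' fun _ _ => negExp_le_one _) (by simp)
      (Eventually.of_forall fun ω => tendsto_prod_negExp _)
    exact Finset.measurable_fun_prod _ fun n _ => hφ'.comp ((hX.measurable n).prodMk (hm n))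
  have hR : Tendsto (fun N => ∫⁻ ω, ∏ n ∈ range N, g (X n ω) ∂P) atTop
      (𝓝 (∫⁻ ω, negExp (∑' n, negLog (g (X n ω))) ∂P)) := by
    refine tendsto_lintegral_of_dominated_convergence (fun _ => 1) (fun k => ?_)
      (fun k => Eventually.of_forall fun ω => prod_le_one' fun _ _ => hg1 _) (by simp)
      (Eventually.of_forall fun ω => ?_)
    · exact Finset.measurable_fun_prod _ fun n _ => hg.comp (hX.measurable n)
    · simpa only [hlog] using tendsto_prod_negExp fun n => negLog (g (X n ω))
  exact tendsto_nhds_unique hL ((tendsto_congr hN).2 hR)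

end IsHomogeneousPPP

/-! ### Integrals over the half-line -/

lemma lintegral_Ioi_exp_neg_mul {a : ℝ} (ha : 0 < a) :
    ∫⁻ t in Set.Ioi (0 : ℝ), ENNReal.ofReal (Real.exp (-a * t)) = ENNReal.ofReal a⁻¹ := by
  rw [← ofReal_integral_eq_lintegral_ofReal (integrableOn_exp_mul_Ioi (by linarith) 0)
    (Eventually.of_forall fun t => (Real.exp_pos _).le), integral_exp_mul_Ioi (by linarith)]
  congr 1
  rw [mul_zero, Real.exp_zero, neg_div_neg_eq, one_div]

lemma lintegral_Ioi_mul_exp_neg_mul_rpow {α b : ℝ} (hα : 0 < α) (hb : 0 < b) :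
    ∫⁻ r in Set.Ioi (0 : ℝ), ENNReal.ofReal (r * Real.exp (-b * r ^ α)) =
      ENNReal.ofReal (b ^ (-(2 / α)) * (1 / α) * Real.Gamma (2 / α)) := by
  have h1 := integrableOn_rpow_mul_exp_neg_mul_rpow (s := 1) (by norm_num) hα hb
  have h2 := integral_rpow_mul_exp_neg_mul_rpow (q := 1) hα (by norm_num) hb
  simp only [Real.rpow_one] at h1 h2
  rw [← ofReal_integral_eq_lintegral_ofReal h1, h2]
  · norm_num [neg_div]
  · filter_upwards [ae_restrict_mem measurableSet_Ioi] with r hr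
    exact mul_nonneg (le_of_lt hr) (Real.exp_pos _).le

/-- Write `1 / (1 + c r^α)` as `∫ exp (-(1 + c r^α) t) dt` and exchange the integrals. The
`r`-integral yields `Γ(2/α) (c t)^(-2/α) / α`, the `t`-integral `Γ(1 - 2/α)`, which converges
because `α > 2`; reflection gives the sine. -/
lemma lintegral_Ioi_div_one_add_mul_rpow {α c : ℝ} (hα : 2 < α) (hc : 0 < c) :
    ∫⁻ r in Set.Ioi (0 : ℝ), ENNReal.ofReal (r / (1 + c * r ^ α)) =
      ENNReal.ofReal (c ^ (-(2 / α)) * (Real.pi / α / Real.sin (2 * Real.pi / α))) := by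
  have hα0 : 0 < α := by linarith
  have hg : 0 < 2 / α := by positivity
  have hg1 : 2 / α < 1 := (div_lt_one hα0).2 hα
  have h1 : ∀ r ∈ Set.Ioi (0 : ℝ), ENNReal.ofReal (r / (1 + c * r ^ α)) =
      ∫⁻ t in Set.Ioi (0 : ℝ), ENNReal.ofReal (Real.exp (-t)) *
        ENNReal.ofReal (r * Real.exp (-(c * t) * r ^ α)) := by
    intro r (hr : 0 < r)
    have hpos : 0 < 1 + c * r ^ α := by positivity
    rw [div_eq_mul_inv, ENNReal.ofReal_mul hr.le, ← lintegral_Ioi_exp_neg_mul hpos,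
      ← lintegral_const_mul _ (by fun_prop)]
    refine lintegral_congr fun t => ?_
    rw [← ENNReal.ofReal_mul hr.le, ← ENNReal.ofReal_mul (Real.exp_pos _).le]
    congr 1
    rw [mul_left_comm, ← Real.exp_add]
    ring_nf
  rw [setLIntegral_congr_fun measurableSet_Ioi h1, lintegral_lintegral_swap (by fun_prop)]
  have h2 : ∀ t ∈ Set.Ioi (0 : ℝ), ∫⁻ r in Set.Ioi (0 : ℝ), ENNReal.ofReal (Real.exp (-t)) *
        ENNReal.ofReal (r * Real.exp (-(c * t) * r ^ α)) =
      ENNReal.ofReal (c ^ (-(2 / α)) * (1 / α) * Real.Gamma (2 / α)) *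
        ENNReal.ofReal (Real.exp (-t) * t ^ ((1 - 2 / α) - 1)) := by
    intro t (ht : 0 < t)
    rw [lintegral_const_mul _ (by fun_prop), lintegral_Ioi_mul_exp_neg_mul_rpow hα0 (by positivity),
      ← ENNReal.ofReal_mul (Real.exp_pos _).le, ← ENNReal.ofReal_mul
        (by have := Real.Gamma_pos_of_pos hg; positivity)]
    congr 1
    rw [Real.mul_rpow hc.le ht.le, show (1 - 2 / α) - 1 = -(2 / α) by ring]
    ring
  rw [setLIntegral_congr_fun measurableSet_Ioi h2, lintegral_const_mul _ (by fun_prop),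
    ← ofReal_integral_eq_lintegral_ofReal (Real.GammaIntegral_convergent (by linarith)),
    ← Real.Gamma_eq_integral (by linarith), ← ENNReal.ofReal_mul
        (by have := Real.Gamma_pos_of_pos hg; positivity)]
  · congr 1
    have := Real.Gamma_mul_Gamma_one_sub (2 / α)
    rw [mul_assoc, this, show 2 * Real.pi / α = Real.pi * (2 / α) by ring]
    ring
  · filter_upwards [ae_restrict_mem measurableSet_Ioi] with t (ht : 0 < t)
    simp only [Pi.zero_apply]
    positivity

/-! ### Exponential law -/

lemma lintegral_expMeasure_one {f : ℝ → ℝ≥0∞} (hf : Measurable f) :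
    ∫⁻ h, f h ∂(expMeasure 1) =
      ∫⁻ h in Set.Ioi (0 : ℝ), ENNReal.ofReal (Real.exp (-h)) * f h := by
  have hm : Measurable (gammaPDF 1 1) := (measurable_gammaPDFReal 1 1).ennreal_ofReal
  rw [expMeasure, gammaMeasure, lintegral_withDensity_eq_lintegral_mul _ hm hf,
    ← setLIntegral_univ, ← Set.Iio_union_Ici (a := (0 : ℝ)), lintegral_union (A := Set.Iio 0) measurableSet_Ici
      (Set.disjoint_left.2 fun x hx hx' => not_lt.2 hx' hx), setLIntegral_congr Ioi_ae_eq_Ici.symm]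
  have h0 : ∫⁻ h in Set.Iio (0 : ℝ), (gammaPDF 1 1 * f) h = 0 := by
    rw [setLIntegral_congr_fun measurableSet_Iio (g := fun _ => 0), lintegral_zero]
    intro x hx
    simp [gammaPDF_of_neg hx]
  rw [h0, zero_add]
  refine setLIntegral_congr_fun measurableSet_Ioi fun x (hx : 0 < x) => ?_
  simp [gammaPDF_of_nonneg hx.le]

/-- The value `y = ∞` is included because a transmitter at the origin has path loss factor `0 ^ (-α)
= ∞`. -/
lemma lintegral_negExp_mul_expMeasure_one (y : ℝ≥0∞) :
    ∫⁻ h, negExp (y * ENNReal.ofReal h) ∂(expMeasure 1) = (1 + y)⁻¹ := by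
  rw [lintegral_expMeasure_one (f := fun h => negExp (y * ENNReal.ofReal h)) (by fun_prop)]
  induction y with
  | top =>
    rw [setLIntegral_congr_fun measurableSet_Ioi (g := fun _ => 0), lintegral_zero]
    · simp
    · intro x (hx : 0 < x)
      simp [ENNReal.top_mul, hx, negExp_top]
  | coe c =>
    have hpos : (0 : ℝ) < 1 + c := by positivity
    have : (1 + (c : ℝ≥0∞))⁻¹ = ENNReal.ofReal (1 + c : ℝ)⁻¹ := by
      rw [ENNReal.ofReal_inv_of_pos hpos, ENNReal.ofReal_add zero_le_one c.coe_nonneg]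
      simp
    rw [this, ← lintegral_Ioi_exp_neg_mul hpos]
    refine setLIntegral_congr_fun measurableSet_Ioi fun x (hx : 0 < x) => ?_
    rw [← ENNReal.ofReal_coe_nnreal, ← ENNReal.ofReal_mul c.coe_nonneg,
      negExp_ofReal (by positivity), ← ENNReal.ofReal_mul (Real.exp_pos _).le, ← Real.exp_add]
    ring_nf

/-- The exponential tail is what turns a coverage probability into a Laplace transform. -/
lemma expMeasure_one_setOf_lt_ofReal (y : ℝ≥0∞) :
    expMeasure 1 {h | y < ENNReal.ofReal h} = negExp y := by
  have := isProbabilityMeasure_expMeasure one_pos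
  induction y with
  | top => simp [negExp_top]
  | coe c =>
    have : {h : ℝ | (c : ℝ≥0∞) < ENNReal.ofReal h} = (Set.Iic (c : ℝ))ᶜ := by
      ext h
      rw [Set.mem_ofPred_eq, ← ENNReal.ofReal_coe_nnreal, Set.compl_Iic, Set.mem_Ioi]
      exact ENNReal.ofReal_lt_ofReal_iff_of_nonneg c.coe_nonneg
    rw [this, prob_compl_eq_one_sub measurableSet_Iic, ← ofReal_cdf, cdf_expMeasure_eq one_pos,
      if_pos c.coe_nonneg, ← ENNReal.ofReal_coe_nnreal, negExp_ofReal c.coe_nonneg,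
      ← ENNReal.ofReal_one, ← ENNReal.ofReal_sub]
    · simp
    · simp

/-! ### Polar coordinates and the Gaussian law on the plane -/

/-- The plane is carried isometrically to `ℂ`, where polar coordinates apply; the angle contributes
`2π`. -/
lemma lintegral_fun_norm_plane {f : ℝ → ℝ≥0∞} (hf : Measurable f) :
    ∫⁻ x : Plane, f ‖x‖ =
      ENNReal.ofReal (2 * Real.pi) * ∫⁻ r in Set.Ioi (0 : ℝ), ENNReal.ofReal r * f r := by
  have h1 : ∫⁻ x : Plane, f ‖x‖ = ∫⁻ z : ℂ, f ‖z‖ := by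
    rw [← (LinearIsometryEquiv.measurePreserving Complex.orthonormalBasisOneI.repr).lintegral_comp
      (f := fun x : Plane => f ‖x‖) (by fun_prop)]
    simp
  rw [h1, ← Complex.lintegral_comp_polarCoord_symm, polarCoord_target, Measure.volume_eq_prod,
    ← Measure.prod_restrict]
  have h2 : ∀ p : ℝ × ℝ, p.1 ∈ Set.Ioi (0 : ℝ) → ENNReal.ofReal p.1 • f ‖Complex.polarCoord.symm p‖ =
      (ENNReal.ofReal p.1 * f p.1) * 1 := by
    intro p (hp : 0 < p.1)
    rw [Complex.norm_polarCoord_symm, abs_of_pos hp, smul_eq_mul, mul_one]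
  have h3 : ∀ᵐ p : ℝ × ℝ ∂((volume.restrict (Set.Ioi (0 : ℝ))).prod
      (volume.restrict (Set.Ioo (-Real.pi) Real.pi))), p.1 ∈ Set.Ioi (0 : ℝ) :=
    Measure.quasiMeasurePreserving_fst.ae (ae_restrict_mem measurableSet_Ioi)
  rw [lintegral_congr_ae (h3.mono h2), lintegral_prod_mul (f := fun r => ENNReal.ofReal r * f r)
    (g := fun _ => 1) (by fun_prop) (by fun_prop), mul_comm]
  congr 1
  simp only [lintegral_const, one_mul, Measure.restrict_apply_univ, Real.volume_Ioo]
  ring_nf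

/-- The standard Gaussian is the product of two real ones, and the product of their densities
depends only on the Euclidean norm. -/
lemma lintegral_stdGaussian_plane {g : Plane → ℝ≥0∞} (hg : Measurable g) :
    ∫⁻ x, g x ∂(stdGaussian Plane) =
      ∫⁻ x, ENNReal.ofReal ((2 * Real.pi)⁻¹ * Real.exp (-‖x‖ ^ 2 / 2)) * g x := by
  set e := (MeasurableEquiv.finTwoArrow (α := ℝ)).symm
  have he : Measurable fun p : ℝ × ℝ => (WithLp.toLp 2 (e p) : Plane) :=
    (PiLp.volume_preserving_toLp (Fin 2)).measurable.comp e.measurable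
  have hE : ∀ p, e p = ![p.1, p.2] := fun p => by
    ext i; fin_cases i <;> rfl
  rw [← map_pi_eq_stdGaussian, lintegral_map hg (PiLp.volume_preserving_toLp (Fin 2)).measurable,
    ← ((measurePreserving_finTwoArrow (gaussianReal 0 1)).symm _).lintegral_comp
      (f := fun y => g (WithLp.toLp 2 y))
      (hg.comp (PiLp.volume_preserving_toLp (Fin 2)).measurable),
    ← (PiLp.volume_preserving_toLp (Fin 2)).lintegral_comp (by fun_prop),
    ← ((volume_preserving_finTwoArrow ℝ).symm _).lintegral_comp (by fun_prop),
    gaussianReal_of_var_ne_zero 0 one_ne_zero, prod_withDensity (by fun_prop) (by fun_prop),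
    lintegral_withDensity_eq_lintegral_mul _ (by fun_prop)
      (g := fun p => g (WithLp.toLp 2 (e p))) (hg.comp he), Measure.volume_eq_prod]
  refine lintegral_congr fun p => ?_
  simp only [Pi.mul_apply]
  congr 1
  rw [gaussianPDF, gaussianPDF, gaussianPDFReal_def, ← ENNReal.ofReal_mul (by positivity)]
  congr 1
  change _ = (2 * Real.pi)⁻¹ * Real.exp (-‖(WithLp.toLp 2 (e p) : Plane)‖ ^ 2 / 2)
  rw [EuclideanSpace.norm_sq_eq, hE]
  simp only [Fin.sum_univ_two, Real.norm_eq_abs, sq_abs, NNReal.coe_one, mul_one, sub_zero,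
    Matrix.cons_val_zero, Matrix.cons_val_one]
  rw [mul_mul_mul_comm, ← Real.exp_add, ← mul_inv, Real.mul_self_sqrt (by positivity)]
  ring_nf

/-- Absence of atoms is used twice: `X0` almost surely avoids the origin and every potential
interferer. -/
lemma map_smul_stdGaussian_singleton {δ : ℝ} (hδ : 0 < δ) (x : Plane) :
    (stdGaussian Plane).map (fun y => δ • y) {x} = 0 := by
  rw [Measure.map_apply (measurable_const_smul δ) (measurableSet_singleton x),
    ← lintegral_indicator_one (measurable_const_smul δ (measurableSet_singleton x)),
    lintegral_stdGaussian_plane (measurable_one.indicator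
      (measurable_const_smul δ (measurableSet_singleton x)))]
  rw [lintegral_eq_zero_iff' (by
    exact AEMeasurable.mul (by fun_prop) (measurable_one.indicator
      (measurable_const_smul δ (measurableSet_singleton x))).aemeasurable)]
  have : ∀ᵐ y : Plane, y ≠ δ⁻¹ • x := by
    rw [ae_iff]; simp
  filter_upwards [this] with y hy
  rw [Set.indicator_of_notMem]
  · simp
  · intro h
    exact hy (by rw [← Set.mem_singleton_iff.1 h, smul_smul, inv_mul_cancel₀ hδ.ne', one_smul])

/-- The norm of a centred Gaussian vector in the plane is Rayleigh distributed. -/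
lemma lintegral_norm_map_smul_stdGaussian {δ : ℝ} (hδ : 0 < δ) {f : ℝ → ℝ≥0∞}
    (hf : Measurable f) :
    ∫⁻ x, f ‖x‖ ∂((stdGaussian Plane).map (fun y => δ • y)) =
      ∫⁻ v in Set.Ioi (0 : ℝ), ENNReal.ofReal (rayleighDensity δ v) * f v := by
  have himg : (fun r : ℝ => δ * r) '' Set.Ioi 0 = Set.Ioi 0 := by
    rw [Set.image_mul_left_Ioi hδ, mul_zero]
  rw [lintegral_map (f := fun x : Plane => f ‖x‖) (by fun_prop) (measurable_const_smul δ),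
    lintegral_stdGaussian_plane (by fun_prop)]
  have h1 := lintegral_fun_norm_plane (f := fun r =>
    ENNReal.ofReal ((2 * Real.pi)⁻¹ * Real.exp (-r ^ 2 / 2)) * f (δ * r)) (by fun_prop)
  simp only [norm_smul, Real.norm_eq_abs, abs_of_pos hδ] at h1 ⊢
  rw [h1, ← lintegral_const_mul _ (by fun_prop)]
  -- Substitution `v = δ r` on the Rayleigh side.
  conv_rhs => rw [← himg]
  rw [lintegral_image_eq_lintegral_abs_deriv_mul measurableSet_Ioi (f' := fun _ => δ)
    (fun x _ => by simpa using ((hasDerivAt_id x).const_mul δ).hasDerivWithinAt)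
    (fun a _ b _ h => mul_left_cancel₀ hδ.ne' h)]
  refine setLIntegral_congr_fun measurableSet_Ioi fun r (hr : 0 < r) => ?_
  rw [← mul_assoc, ← mul_assoc, ← mul_assoc, ← ENNReal.ofReal_mul (by positivity),
    ← ENNReal.ofReal_mul (by positivity), ← ENNReal.ofReal_mul (by positivity)]
  congr 2
  rw [rayleighDensity, abs_of_pos hδ]
  have : -(δ * r) ^ 2 / (2 * δ ^ 2) = -r ^ 2 / 2 := by field_simp
  rw [this]
  field_simp

/-! ### Shot noise of a thinned Poisson point process with Rayleigh fading -/

section ShotNoise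

variable {Ω : Type*}

/-- Power received at the origin from those transmitters `X n` that are switched on. -/
def shotNoise (α pow : ℝ) (X : ℕ → Ω → Plane) (b : ℕ → Ω → Bool) (h : ℕ → Ω → ℝ) (ω : Ω) : ℝ≥0∞ :=
  ∑' n, if b n ω = true then SharedNetwork.receivedPower α pow (h n ω) (X n ω) else 0

lemma measurable_receivedPower (α pow : ℝ) :
    Measurable fun z : ℝ × Plane => SharedNetwork.receivedPower α pow z.1 z.2 := by
  unfold SharedNetwork.receivedPower
  fun_prop

variable [MeasurableSpace Ω]

lemma measurable_shotNoise (α pow : ℝ) {X : ℕ → Ω → Plane} {b : ℕ → Ω → Bool} {h : ℕ → Ω → ℝ}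
    (hX : ∀ n, Measurable (X n)) (hb : ∀ n, Measurable (b n)) (hh : ∀ n, Measurable (h n)) :
    Measurable (shotNoise α pow X b h) :=
  Measurable.tsum fun n => Measurable.ite (hb n (measurableSet_singleton true))
    ((measurable_receivedPower α pow).comp ((hh n).prodMk (hX n))) measurable_const

variable {P : Measure Ω} [IsProbabilityMeasure P]

/-- A switched-on transmitter contributes the exponential transform `(1 + y)⁻¹`, a silent one
contributes `1`. -/
lemma lintegral_negExp_ite_fading {b : Ω → Bool} {h : Ω → ℝ} (hb : Measurable b)
    (hh : Measurable h) (hbh : IndepFun b h P) {ρ : ℝ}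
    (hbρ : P {ω | b ω = true} = ENNReal.ofReal ρ) (hhl : P.map h = expMeasure 1) (y : ℝ≥0∞) :
    ∫⁻ ω, negExp (if b ω = true then y * ENNReal.ofReal (h ω) else 0) ∂P =
      ENNReal.ofReal ρ * (1 + y)⁻¹ + (1 - ENNReal.ofReal ρ) := by
  have hset : MeasurableSet {ω | b ω = true} := hb (measurableSet_singleton true)
  have hm : Measurable fun z : Bool × ℝ => negExp (if z.1 = true then y * ENNReal.ofReal z.2 else 0) :=
    measurable_negExp.comp (Measurable.ite (measurable_fst (measurableSet_singleton true))
      (by fun_prop) measurable_const)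
  rw [IndepFun.lintegral_comp_prodMk hb hh hbh hm]
  have hin : ∀ ω, ∫⁻ ω', negExp (if b ω = true then y * ENNReal.ofReal (h ω') else 0) ∂P =
      {ω | b ω = true}.indicator (fun _ => (1 + y)⁻¹) ω +
        {ω | b ω = true}ᶜ.indicator (fun _ => 1) ω := by
    intro ω
    by_cases hω : b ω = true
    · rw [Set.indicator_of_mem (by exact hω), Set.indicator_of_notMem (by simpa using hω), add_zero]
      simp only [hω, if_true]
      rw [← lintegral_negExp_mul_expMeasure_one, ← hhl, lintegral_map (by fun_prop) hh]
    · rw [Set.indicator_of_notMem (by exact hω), Set.indicator_of_mem (by simpa using hω), zero_add]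
      simp [hω, negExp_zero]
  simp only [hin]
  rw [lintegral_add_left (measurable_const.indicator hset), lintegral_indicator_const hset,
    lintegral_indicator_const hset.compl, prob_compl_eq_one_sub hset, hbρ, one_mul, mul_comm]

/-- With `y = t pow r^(-α)` both sides equal `ρ y / (1 + y)`. Passing to real numbers avoids
truncated subtraction. -/
lemma one_sub_thinned_fading {α pow t ρ : ℝ} (hpow : 0 < pow) (ht : 0 < t)
    (hρ : ρ ∈ Set.Icc (0 : ℝ) 1) {r : ℝ} (hr : 0 < r) :
    1 - (ENNReal.ofReal ρ *
        (1 + ENNReal.ofReal t * ENNReal.ofReal pow * ENNReal.ofReal r ^ (-α))⁻¹ +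
      (1 - ENNReal.ofReal ρ)) = ENNReal.ofReal (ρ / (1 + (t * pow)⁻¹ * r ^ α)) := by
  have hrα : 0 < r ^ α := by positivity
  set y : ℝ := t * pow * r ^ (-α) with hy
  have hy0 : 0 < y := by positivity
  have hρ1 : 0 ≤ 1 - ρ := sub_nonneg.2 hρ.2
  have hρ0 := hρ.1
  rw [ENNReal.ofReal_rpow_of_pos hr, ← ENNReal.ofReal_mul ht.le, ← ENNReal.ofReal_mul (by positivity),
    ← hy, ← ENNReal.ofReal_one, ← ENNReal.ofReal_add zero_le_one hy0.le,
    ← ENNReal.ofReal_inv_of_pos (by positivity), ← ENNReal.ofReal_mul hρ.1,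
    ← ENNReal.ofReal_sub _ hρ.1, ← ENNReal.ofReal_add (by positivity) hρ1,
    ← ENNReal.ofReal_sub _ (by positivity)]
  congr 1
  rw [hy, Real.rpow_neg hr.le]
  field_simp
  ring

/-- Laplace transform of the shot noise of an independently thinned homogeneous Poisson point
process with Rayleigh fading and path loss `|x|^(-α)`. -/
theorem IsHomogeneousPPP.lintegral_negExp_shotNoise {X : ℕ → Ω → Plane} {lam : ℝ}
    (hX : IsHomogeneousPPP X lam P) (hlam : 0 ≤ lam) {b : ℕ → Ω → Bool} {h : ℕ → Ω → ℝ}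
    (hb : ∀ n, Measurable (b n)) (hh : ∀ n, Measurable (h n)) {ρ : ℝ}
    (hρ : ρ ∈ Set.Icc (0 : ℝ) 1) (hbρ : ∀ n, P {ω | b n ω = true} = ENNReal.ofReal ρ)
    (hhl : ∀ n, P.map (h n) = expMeasure 1) (hbh : ∀ n, IndepFun (b n) (h n) P)
    (hmi : iIndepFun (fun n ω => (b n ω, h n ω)) P)
    (hXm : IndepFun (fun ω n => X n ω) (fun ω n => (b n ω, h n ω)) P)
    {α pow t : ℝ} (hα : 2 < α) (hpow : 0 < pow) (ht : 0 < t) :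
    ∫⁻ ω, negExp (ENNReal.ofReal t * shotNoise α pow X b h ω) ∂P =
      ENNReal.ofReal (Real.exp (-(lam * ρ * ((2 * Real.pi ^ 2 / α) / Real.sin (2 * Real.pi / α)) *
        (t * pow) ^ (2 / α)))) := by
  have hα0 : 0 < α := by linarith
  have hsin : 0 < Real.sin (2 * Real.pi / α) := by
    apply Real.sin_pos_of_pos_of_lt_pi (by positivity)
    rw [div_lt_iff₀ hα0]
    nlinarith [Real.pi_pos]
  have hρ0 := hρ.1
  -- The mark of a point is its on/off decision together with its fading; `φ` is its contribution to
  -- `t I`.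
  let φ : Plane × (Bool × ℝ) → ℝ≥0∞ := fun z => if z.2.1 = true then
    (ENNReal.ofReal t * ENNReal.ofReal pow * ENNReal.ofReal ‖z.1‖ ^ (-α)) * ENNReal.ofReal z.2.2
    else 0
  have hφ : Measurable φ := Measurable.ite
    ((measurable_fst.comp measurable_snd) (measurableSet_singleton true)) (by fun_prop)
    measurable_const
  have hsum : ∀ ω, ENNReal.ofReal t * shotNoise α pow X b h ω =
      ∑' n, φ (X n ω, (b n ω, h n ω)) := by
    intro ω
    rw [shotNoise, ← ENNReal.tsum_mul_left]
    refine tsum_congr fun n => ?_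
    simp only [φ, SharedNetwork.receivedPower]
    split_ifs
    · rw [ENNReal.ofReal_mul hpow.le]; ring
    · rw [mul_zero]
  simp only [hsum]
  rw [hX.lintegral_negExp_marked (fun n => (hb n).prodMk (hh n)) hmi hXm hφ
    (g := fun x => ENNReal.ofReal ρ *
        (1 + ENNReal.ofReal t * ENNReal.ofReal pow * ENNReal.ofReal ‖x‖ ^ (-α))⁻¹ +
      (1 - ENNReal.ofReal ρ)) fun n x =>
    lintegral_negExp_ite_fading (hb n) (hh n) (hbh n) (hbρ n) (hhl n)
      (ENNReal.ofReal t * ENNReal.ofReal pow * ENNReal.ofReal ‖x‖ ^ (-α))]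
  have hint : ∫⁻ x : Plane, (1 - (ENNReal.ofReal ρ *
        (1 + ENNReal.ofReal t * ENNReal.ofReal pow * ENNReal.ofReal ‖x‖ ^ (-α))⁻¹ +
      (1 - ENNReal.ofReal ρ))) =
      ∫⁻ x : Plane, ENNReal.ofReal (ρ / (1 + (t * pow)⁻¹ * ‖x‖ ^ α)) := by
    have h0 : ∀ᵐ x : Plane, x ≠ 0 := by rw [ae_iff]; simp
    refine lintegral_congr_ae ?_
    filter_upwards [h0] with x hx
    exact one_sub_thinned_fading hpow ht hρ (norm_pos_iff.2 hx)
  have hpolar := lintegral_fun_norm_plane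
    (f := fun r => ENNReal.ofReal (ρ / (1 + (t * pow)⁻¹ * r ^ α))) (by fun_prop)
  have hrad : ∫⁻ r in Set.Ioi (0 : ℝ), ENNReal.ofReal r *
      ENNReal.ofReal (ρ / (1 + (t * pow)⁻¹ * r ^ α)) =
      ENNReal.ofReal ρ * ∫⁻ r in Set.Ioi (0 : ℝ), ENNReal.ofReal (r / (1 + (t * pow)⁻¹ * r ^ α)) := by
    rw [← lintegral_const_mul _ (by fun_prop)]
    refine setLIntegral_congr_fun measurableSet_Ioi fun r (hr : 0 < r) => ?_
    rw [← ENNReal.ofReal_mul hr.le, ← ENNReal.ofReal_mul hρ0]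
    congr 1
    ring
  rw [hint, hpolar, hrad, lintegral_Ioi_div_one_add_mul_rpow hα (by positivity),
    ← ENNReal.ofReal_mul hρ0, ← ENNReal.ofReal_mul (by positivity), ← ENNReal.ofReal_mul hlam,
    negExp_ofReal (by positivity)]
  congr 3
  rw [Real.rpow_neg (by positivity), Real.inv_rpow (by positivity), inv_inv]
  ring

end ShotNoise

/-! ### Laplace transforms and almost sure finiteness -/

section Laplace

lemma laplaceTransform_nonneg {Ω : Type*} [MeasurableSpace Ω] (P : Measure Ω) (I : Ω → ℝ≥0∞)
    (s : ℝ) : 0 ≤ laplaceTransform P I s :=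
  integral_nonneg fun _ => (Real.exp_pos _).le

variable {Ω : Type*} [MeasurableSpace Ω] {P : Measure Ω} [IsProbabilityMeasure P] {I : Ω → ℝ≥0∞}

/-- For `t > 0` the variable `exp (-t I)` vanishes where `I = ∞`, so its mean is at most `P (I <
∞)`. As `t ↓ 0` the prescribed mean tends to `1`, since `γ > 0`. -/
lemma ae_lt_top_of_lintegral_negExp (hI : Measurable I) {C pow γ : ℝ} (hγ : 0 < γ)
    (h : ∀ t : ℝ, 0 < t → ∫⁻ ω, negExp (ENNReal.ofReal t * I ω) ∂P =
      ENNReal.ofReal (Real.exp (-(C * (t * pow) ^ γ)))) :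
    ∀ᵐ ω ∂P, I ω < ∞ := by
  have hset : MeasurableSet {ω | I ω < ∞} := measurableSet_lt hI measurable_const
  have hle : ∀ t : ℝ, 0 < t → ENNReal.ofReal (Real.exp (-(C * (t * pow) ^ γ))) ≤ P {ω | I ω < ∞} := by
    intro t ht
    rw [← h t ht, ← lintegral_indicator_one hset]
    refine lintegral_mono fun ω => ?_
    by_cases hω : I ω < ∞
    · rw [Set.indicator_of_mem (by exact hω)]
      exact negExp_le_one _
    · rw [not_lt_top_iff.1 hω, ENNReal.mul_top (by simpa using ht), negExp_top]
      exact zero_le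
  have hlim : Tendsto (fun t : ℝ => ENNReal.ofReal (Real.exp (-(C * (t * pow) ^ γ)))) (𝓝[>] 0) (𝓝 1) := by
    have hc : Continuous fun t : ℝ => ENNReal.ofReal (Real.exp (-(C * (t * pow) ^ γ))) := by
      have := Real.continuous_rpow_const (q := γ) hγ.le
      exact ENNReal.continuous_ofReal.comp (by fun_prop)
    have := (hc.tendsto 0).mono_left (nhdsWithin_le_nhds (s := Set.Ioi 0))
    simpa [Real.zero_rpow hγ.ne'] using this
  have h1 : 1 ≤ P {ω | I ω < ∞} := le_of_tendsto hlim <| by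
    filter_upwards [self_mem_nhdsWithin] with t ht using hle t ht
  exact (prob_compl_eq_zero_iff hset).2 (le_antisymm prob_le_one h1)

/-- Finiteness matters because `toReal` sends `∞` to `0`, where the real integrand would be `1`
instead of `exp (-∞) = 0`. -/
lemma ofReal_laplaceTransform (hI : Measurable I) (hfin : ∀ᵐ ω ∂P, I ω < ∞) {s : ℝ} (hs : 0 ≤ s) :
    ENNReal.ofReal (laplaceTransform P I s) = ∫⁻ ω, negExp (ENNReal.ofReal s * I ω) ∂P := by
  rw [laplaceTransform, ofReal_integral_eq_lintegral_ofReal _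
    (Eventually.of_forall fun ω => (Real.exp_pos _).le)]
  · refine lintegral_congr_ae ?_
    filter_upwards [hfin] with ω hω
    rw [negExp_eq_ofReal (ENNReal.mul_ne_top ENNReal.ofReal_ne_top hω.ne), ENNReal.toReal_mul,
      ENNReal.toReal_ofReal hs, neg_mul]
  · refine Integrable.of_bound (C := 1) (by
      exact (Real.measurable_exp.comp (hI.ennreal_toReal.const_mul _)).aestronglyMeasurable)
      (Eventually.of_forall fun ω => ?_)
    rw [Real.norm_eq_abs, Real.abs_exp, Real.exp_le_one_iff, neg_mul, neg_nonpos]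
    exact mul_nonneg hs ENNReal.toReal_nonneg

lemma laplaceTransform_eq_of_lintegral_negExp (hI : Measurable I) {C pow γ : ℝ} (hγ : 0 < γ)
    (h : ∀ t : ℝ, 0 < t → ∫⁻ ω, negExp (ENNReal.ofReal t * I ω) ∂P =
      ENNReal.ofReal (Real.exp (-(C * (t * pow) ^ γ)))) {s : ℝ} (hs : 0 ≤ s) :
    laplaceTransform P I s = Real.exp (-(C * (s * pow) ^ γ)) := by
  rcases hs.eq_or_lt with rfl | hs'
  · simp [laplaceTransform, Real.zero_rpow hγ.ne']
  · have := ofReal_laplaceTransform hI (ae_lt_top_of_lintegral_negExp hI hγ h) hs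
    rw [h s hs'] at this
    exact (ENNReal.ofReal_eq_ofReal_iff (laplaceTransform_nonneg P I s) (Real.exp_pos _).le).1 this

end Laplace

/-! ### The shared network -/

namespace RandomSource

variable {M : ℕ}

/-- Sources attached to the `n`-th potential D2D transmitter of type `i`. -/
def markD (i : Fin M) (n : ℕ) : Set (RandomSource M) := {timeD i n, freqD i n, fadingD i n}

/-- Sources attached to the `n`-th base station. -/
def markB (n : ℕ) : Set (RandomSource M) := {onB n, fadingB n}

/-- Sources attached to the D2D transmitters of type `i`. -/
def groupD (i : Fin M) : Set (RandomSource M) := insert (posD i) (⋃ n, markD i n)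

/-- Sources attached to the base stations. -/
def groupB : Set (RandomSource M) := insert posB (⋃ n, markB n)

lemma pairwise_disjoint_markD (i : Fin M) :
    Pairwise (fun n m => Disjoint (markD i n) (markD i m)) := fun n m hnm => by
  simp [markD, hnm.symm]

lemma pairwise_disjoint_markB :
    Pairwise (fun n m => Disjoint (markB n : Set (RandomSource M)) (markB m)) := fun n m hnm => by
  simp [markB, hnm.symm]

lemma pairwise_disjoint_groupD :
    Pairwise (fun i j => Disjoint (groupD i : Set (RandomSource M)) (groupD j)) := fun i j hij => by
  simp [groupD, markD, hij.symm]

lemma disjoint_groupD_groupB (i : Fin M) : Disjoint (groupD i) groupB := by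
  simp [groupD, groupB, markD, markB]

end RandomSource

namespace SharedNetwork

open RandomSource

variable {M : ℕ} {Ω : Type*}

/-- The σ-algebra generated by a set of sources of randomness. -/
abbrev sigmaOf (S : SharedNetwork M Ω) (A : Set (RandomSource M)) : MeasurableSpace Ω :=
  ⨆ l ∈ A, S.sourceSigma l

/-- Whether a potential D2D transmitter is active on the subband considered. -/
def onD (S : SharedNetwork M Ω) (i : Fin M) (n : ℕ) (ω : Ω) : Bool :=
  S.timeD i n ω && S.freqD i n ω

/-- Interference from all active D2D transmitters of type `i`, wherever they are located. -/
def noiseD (S : SharedNetwork M Ω) (p : NetworkParams M) (i : Fin M) : Ω → ℝ≥0∞ :=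
  shotNoise p.α p.PD (S.XD i) (S.onD i) (S.hD i)

/-- Interference from all active D2D transmitters, wherever they are located. -/
def totalNoiseD (S : SharedNetwork M Ω) (p : NetworkParams M) (ω : Ω) : ℝ≥0∞ :=
  ∑ i, S.noiseD p i ω

lemma interferenceB_eq_shotNoise (S : SharedNetwork M Ω) (p : NetworkParams M) :
    S.interferenceB p = shotNoise p.α p.PB S.XB S.onB S.hB := by
  funext ω
  refine tsum_congr fun n => ?_
  by_cases h : S.onB n ω = true
  · rw [Set.indicator_of_mem (by exact h), if_pos h]
  · rw [Set.indicator_of_notMem (by exact h), if_neg h]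

/-- Measurability is tracked relative to sets of sources, so that every later independence claim
reduces to disjointness of label sets. -/
lemma measurable_sigmaOf {E : Type*} [MeasurableSpace E] (S : SharedNetwork M Ω)
    {A : Set (RandomSource M)} {l : RandomSource M} (hl : l ∈ A) {f : Ω → E}
    (hf : Measurable[S.sourceSigma l] f) : Measurable[S.sigmaOf A] f :=
  hf.mono (le_biSup S.sourceSigma hl) le_rfl

lemma measurable_XD (S : SharedNetwork M Ω) (i : Fin M) (n : ℕ) :
    Measurable[S.sourceSigma (posD i)] (S.XD i n) :=
  measurable_iff_comap_le.2
    (le_iSup (fun n => MeasurableSpace.comap (S.XD i n) inferInstance) n)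

lemma measurable_XB (S : SharedNetwork M Ω) (n : ℕ) :
    Measurable[S.sourceSigma posB] (S.XB n) :=
  measurable_iff_comap_le.2 (le_iSup (fun n => MeasurableSpace.comap (S.XB n) inferInstance) n)

lemma measurable_onD (S : SharedNetwork M Ω) {A : Set (RandomSource M)} {i : Fin M} {n : ℕ}
    (ht : RandomSource.timeD i n ∈ A) (hf : RandomSource.freqD i n ∈ A) :
    Measurable[S.sigmaOf A] (S.onD i n) := by
  have h1 : Measurable[S.sigmaOf A] (S.timeD i n) :=
    S.measurable_sigmaOf ht (comap_measurable _)
  have h2 : Measurable[S.sigmaOf A] (S.freqD i n) :=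
    S.measurable_sigmaOf hf (comap_measurable _)
  exact (measurable_of_countable fun z : Bool × Bool => z.1 && z.2).comp (h1.prodMk h2)

lemma measurable_markD (S : SharedNetwork M Ω) {A : Set (RandomSource M)} {i : Fin M} {n : ℕ}
    (h : markD i n ⊆ A) :
    Measurable[S.sigmaOf A] (fun ω => (S.onD i n ω, S.hD i n ω)) := by
  have h1 : Measurable[S.sigmaOf A] (S.onD i n) :=
    S.measurable_onD (h (by simp [markD])) (h (by simp [markD]))
  have h2 : Measurable[S.sigmaOf A] (S.hD i n) :=
    S.measurable_sigmaOf (h (a := fadingD i n) (by simp [markD])) (comap_measurable _)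
  exact h1.prodMk h2

lemma measurable_markB (S : SharedNetwork M Ω) {A : Set (RandomSource M)} {n : ℕ}
    (h : markB n ⊆ A) :
    Measurable[S.sigmaOf A] (fun ω => (S.onB n ω, S.hB n ω)) := by
  have h1 : Measurable[S.sigmaOf A] (S.onB n) :=
    S.measurable_sigmaOf (h (a := RandomSource.onB n) (by simp [markB])) (comap_measurable _)
  have h2 : Measurable[S.sigmaOf A] (S.hB n) :=
    S.measurable_sigmaOf (h (a := fadingB n) (by simp [markB])) (comap_measurable _)
  exact h1.prodMk h2

lemma measurable_noiseD (S : SharedNetwork M Ω) (p : NetworkParams M) {A : Set (RandomSource M)}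
    {i : Fin M} (h : groupD i ⊆ A) : Measurable[S.sigmaOf A] (S.noiseD p i) := by
  have hm := fun n => S.measurable_markD
    (((Set.subset_iUnion (markD i) n).trans (Set.subset_insert _ _)).trans h)
  exact @measurable_shotNoise Ω (S.sigmaOf A) _ _ _ _ _
    (fun n => S.measurable_sigmaOf (h (Set.mem_insert _ _)) (S.measurable_XD i n))
    (fun n => measurable_fst.comp (hm n)) (fun n => measurable_snd.comp (hm n))

lemma measurable_totalNoiseD (S : SharedNetwork M Ω) (p : NetworkParams M)
    {A : Set (RandomSource M)} (h : ∀ i, groupD i ⊆ A) :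
    Measurable[S.sigmaOf A] (S.totalNoiseD p) :=
  @Finset.measurable_fun_sum _ _ _ _ _ _ (S.sigmaOf A) _ _ fun i _ => S.measurable_noiseD p (h i)

lemma measurable_interferenceB (S : SharedNetwork M Ω) (p : NetworkParams M)
    {A : Set (RandomSource M)} (h : groupB ⊆ A) : Measurable[S.sigmaOf A] (S.interferenceB p) := by
  have hm := fun n => S.measurable_markB
    (((Set.subset_iUnion markB n).trans (Set.subset_insert _ _)).trans h)
  rw [interferenceB_eq_shotNoise]
  exact @measurable_shotNoise Ω (S.sigmaOf A) _ _ _ _ _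
    (fun n => S.measurable_sigmaOf (h (Set.mem_insert _ _)) (S.measurable_XB n))
    (fun n => measurable_fst.comp (hm n)) (fun n => measurable_snd.comp (hm n))

/-! ### Independence in the model and Laplace transforms of the interferences -/

namespace IsModel

variable [MeasurableSpace Ω] {P : Measure Ω} {p : NetworkParams M} {S : SharedNetwork M Ω}

lemma sourceSigma_le (hS : S.IsModel p P) (l : RandomSource M) :
    S.sourceSigma l ≤ ‹MeasurableSpace Ω› := by
  cases l with
  | typicalPos => exact hS.X0_measurable.comap_le
  | typicalFading => exact hS.h0_measurable.comap_le
  | posD i => exact iSup_le fun n => ((hS.XD_ppp i).measurable n).comap_le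
  | timeD i n => exact (hS.timeD_measurable i n).comap_le
  | freqD i n => exact (hS.freqD_measurable i n).comap_le
  | fadingD i n => exact (hS.hD_measurable i n).comap_le
  | posB => exact iSup_le fun n => (hS.XB_ppp.measurable n).comap_le
  | onB n => exact (hS.onB_measurable n).comap_le
  | fadingB n => exact (hS.hB_measurable n).comap_le

lemma measurable_of_sigmaOf (hS : S.IsModel p P) {E : Type*} [MeasurableSpace E] {f : Ω → E}
    {A : Set (RandomSource M)} (hf : Measurable[S.sigmaOf A] f) : Measurable f :=
  hf.mono (iSup₂_le fun l _ => hS.sourceSigma_le l) le_rfl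

lemma indepFun (hS : S.IsModel p P) {E F : Type*} [MeasurableSpace E] [MeasurableSpace F]
    {f : Ω → E} {g : Ω → F} {A B : Set (RandomSource M)} (hAB : Disjoint A B)
    (hf : Measurable[S.sigmaOf A] f) (hg : Measurable[S.sigmaOf B] g) : IndepFun f g P := by
  have h := indep_iSup_of_disjoint hS.sourceSigma_le hS.indep hAB
  exact (IndepFun_iff_Indep f g P).2
    (indep_of_indep_of_le_left (indep_of_indep_of_le_right h hg.comap_le) hf.comap_le)

lemma measurable_onD (hS : S.IsModel p P) (i : Fin M) (n : ℕ) : Measurable (S.onD i n) :=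
  hS.measurable_of_sigmaOf (S.measurable_onD (Set.mem_univ _) (Set.mem_univ _))

lemma measurable_totalNoiseD (hS : S.IsModel p P) : Measurable (S.totalNoiseD p) :=
  hS.measurable_of_sigmaOf (S.measurable_totalNoiseD p fun _ => Set.subset_univ _)

lemma measurable_interferenceB (hS : S.IsModel p P) : Measurable (S.interferenceB p) :=
  hS.measurable_of_sigmaOf (S.measurable_interferenceB p (Set.subset_univ _))

lemma onD_law (hS : S.IsModel p P) (hp : p.Valid) (i : Fin M) (n : ℕ) :
    P {ω | S.onD i n ω = true} = ENNReal.ofReal (p.pt i * p.pf i) := by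
  have h : IndepFun (S.timeD i n) (S.freqD i n) P :=
    hS.indepFun (A := {RandomSource.timeD i n}) (B := {RandomSource.freqD i n}) (by simp)
      (S.measurable_sigmaOf (Set.mem_singleton _) (comap_measurable _))
      (S.measurable_sigmaOf (Set.mem_singleton _) (comap_measurable _))
  have := h.measure_inter_preimage_eq_mul {true} {true} (measurableSet_singleton _)
    (measurableSet_singleton _)
  rw [ENNReal.ofReal_mul (hp.pt_mem i).1, ← hS.timeD_law i n, ← hS.freqD_law i n]
  convert this using 3 <;> ext ω <;> simp [onD]

variable [IsProbabilityMeasure P]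

lemma iIndepFun (hS : S.IsModel p P) {κ : Type*} {E : κ → Type*} [∀ k, MeasurableSpace (E k)]
    {f : ∀ k, Ω → E k} {T : κ → Set (RandomSource M)}
    (hT : Pairwise (fun j k => Disjoint (T j) (T k)))
    (hf : ∀ k, Measurable[S.sigmaOf (T k)] (f k)) : iIndepFun f P :=
  (iIndepFun_iff_iIndep _ _ _).2 <| iIndep_of_iIndep_of_le
    (iIndep_iSup_of_pairwise_disjoint hS.sourceSigma_le hS.indep T hT) fun k => (hf k).comap_le

lemma lintegral_negExp_noiseD (hS : S.IsModel p P) (hp : p.Valid) (i : Fin M) {t : ℝ}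
    (ht : 0 < t) :
    ∫⁻ ω, negExp (ENNReal.ofReal t * S.noiseD p i ω) ∂P =
      ENNReal.ofReal (Real.exp (-(p.lamD i * (p.pt i * p.pf i) *
        ((2 * Real.pi ^ 2 / p.α) / Real.sin (2 * Real.pi / p.α)) * (t * p.PD) ^ (2 / p.α)))) := by
  have hpt := hp.pt_mem i
  have hpf := hp.pf_mem i
  refine (hS.XD_ppp i).lintegral_negExp_shotNoise (hp.lamD_pos i).le (hS.measurable_onD i)
    (hS.hD_measurable i)
    ⟨mul_nonneg hpt.1 hpf.1, mul_le_one₀ hpt.2 hpf.1 hpf.2⟩ (hS.onD_law hp i)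
    (hS.hD_law i) (fun n => ?_) ?_ ?_ hp.two_lt_α hp.PD_pos ht
  · refine hS.indepFun (A := {RandomSource.timeD i n, RandomSource.freqD i n}) (B := {fadingD i n})
      (by simp)
      (S.measurable_onD (by simp) (by simp))
      (S.measurable_sigmaOf (Set.mem_singleton _) (comap_measurable _))
  · exact hS.iIndepFun (pairwise_disjoint_markD i) fun n => S.measurable_markD subset_rfl
  · refine hS.indepFun (A := {posD i}) (B := ⋃ n, markD i n) (by simp [markD])
      (@measurable_pi_lambda _ _ _ (S.sigmaOf _) _ _
        fun n => S.measurable_sigmaOf (Set.mem_singleton _) (S.measurable_XD i n))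
      (@measurable_pi_lambda _ _ _ (S.sigmaOf _) _ _
        fun n => S.measurable_markD (Set.subset_iUnion _ n))

/-- The types use disjoint groups of sources, so their transforms multiply and the thinned densities
add up to `lamDTilde`; superposition of point processes is not needed. -/
lemma lintegral_negExp_totalNoiseD (hS : S.IsModel p P) (hp : p.Valid) {t : ℝ} (ht : 0 < t) :
    ∫⁻ ω, negExp (ENNReal.ofReal t * S.totalNoiseD p ω) ∂P =
      ENNReal.ofReal (Real.exp (-(p.lamDTilde *
        ((2 * Real.pi ^ 2 / p.α) / Real.sin (2 * Real.pi / p.α)) * (t * p.PD) ^ (2 / p.α)))) := by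
  have hind : ProbabilityTheory.iIndepFun (fun i => S.noiseD p i) P :=
    hS.iIndepFun pairwise_disjoint_groupD fun i => S.measurable_noiseD p subset_rfl
  have hm : Measurable fun x => negExp (ENNReal.ofReal t * x) := by fun_prop
  have h := lintegral_prod_eq_prod_lintegral_of_indepFun univ _ (hind.comp _ fun _ => hm)
    fun i => hm.comp (hS.measurable_of_sigmaOf (S.measurable_noiseD p (i := i) subset_rfl))
  simp only [totalNoiseD, Finset.mul_sum, negExp_sum]
  refine h.trans ?_
  simp only [Function.comp_apply, hS.lintegral_negExp_noiseD hp _ ht]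
  rw [← ENNReal.ofReal_prod_of_nonneg fun i _ => (Real.exp_pos _).le, ← Real.exp_sum,
    Finset.sum_neg_distrib, NetworkParams.lamDTilde, Finset.sum_mul, Finset.sum_mul]
  congr 3
  exact sum_congr rfl fun i _ => by ring

lemma lintegral_negExp_interferenceB (hS : S.IsModel p P) (hp : p.Valid) {t : ℝ} (ht : 0 < t) :
    ∫⁻ ω, negExp (ENNReal.ofReal t * S.interferenceB p ω) ∂P =
      ENNReal.ofReal (Real.exp (-(p.lamB * p.rhoS *
        ((2 * Real.pi ^ 2 / p.α) / Real.sin (2 * Real.pi / p.α)) * (t * p.PB) ^ (2 / p.α)))) := by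
  have hρ : p.rhoS ∈ Set.Icc (0 : ℝ) 1 := by
    refine ⟨le_min (div_nonneg (add_nonneg (mul_nonneg hp.bC_nonneg hp.lamU_nonneg) ?_)
      (mul_pos hp.lamB_pos hp.B_pos).le) zero_le_one, min_le_right _ _⟩
    exact sum_nonneg fun i _ => mul_nonneg (mul_nonneg (hp.bD_nonneg i)
      (sub_nonneg.2 (hp.pt_mem i).2)) (hp.lamD_pos i).le
  rw [interferenceB_eq_shotNoise]
  refine hS.XB_ppp.lintegral_negExp_shotNoise hp.lamB_pos.le hS.onB_measurable
    hS.hB_measurable hρ hS.onB_law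
    hS.hB_law (fun n => ?_) ?_ ?_ hp.two_lt_α hp.PB_pos ht
  · refine hS.indepFun (A := {RandomSource.onB n}) (B := {fadingB n}) (by simp)
      (S.measurable_sigmaOf (Set.mem_singleton _) (comap_measurable _))
      (S.measurable_sigmaOf (Set.mem_singleton _) (comap_measurable _))
  · exact hS.iIndepFun pairwise_disjoint_markB fun n => S.measurable_markB subset_rfl
  · refine hS.indepFun (A := {posB}) (B := ⋃ n, markB n) (by simp [markB])
      (@measurable_pi_lambda _ _ _ (S.sigmaOf _) _ _
        fun n => S.measurable_sigmaOf (Set.mem_singleton _) (S.measurable_XB n))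
      (@measurable_pi_lambda _ _ _ (S.sigmaOf _) _ _
        fun n => S.measurable_markB (Set.subset_iUnion _ n))

end IsModel

end SharedNetwork

/-- This is the radial integral of the shot noise with `c = β⁻¹ P_D / P_B`; its finite value also
gives integrability. -/
lemma NetworkParams.Valid.H0_eq {M : ℕ} {p : NetworkParams M} (hp : p.Valid) {β : ℝ}
    (hβ : 0 < β) :
    IntegrableOn (fun x : ℝ => x / (1 + β⁻¹ * (p.PD / p.PB) * x ^ p.α)) (Set.Ioi 0) ∧
    p.H0 β = (β⁻¹ * (p.PD / p.PB)) ^ (-(2 / p.α)) *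
      (Real.pi / p.α / Real.sin (2 * Real.pi / p.α)) := by
  have hα := hp.two_lt_α
  have hα0 : 0 < p.α := by linarith
  have hPD := hp.PD_pos
  have hPB := hp.PB_pos
  have hc : 0 < β⁻¹ * (p.PD / p.PB) := by positivity
  have hsin : 0 < Real.sin (2 * Real.pi / p.α) := by
    apply Real.sin_pos_of_pos_of_lt_pi (by positivity)
    rw [div_lt_iff₀ hα0]
    nlinarith [Real.pi_pos]
  have hl := lintegral_Ioi_div_one_add_mul_rpow hα hc
  have hm : AEStronglyMeasurable (fun x : ℝ => x / (1 + β⁻¹ * (p.PD / p.PB) * x ^ p.α))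
      (volume.restrict (Set.Ioi 0)) := by
    exact Measurable.aestronglyMeasurable (by fun_prop)
  have hnn : 0 ≤ᵐ[volume.restrict (Set.Ioi 0)]
      fun x : ℝ => x / (1 + β⁻¹ * (p.PD / p.PB) * x ^ p.α) := by
    filter_upwards [ae_restrict_mem measurableSet_Ioi] with x (hx : 0 < x)
    simp only [Pi.zero_apply]
    positivity
  refine ⟨⟨hm, ?_⟩, ?_⟩
  · rw [hasFiniteIntegral_iff_ofReal hnn, hl]
    exact ENNReal.ofReal_lt_top
  · rw [NetworkParams.H0, integral_eq_lintegral_of_nonneg_ae hnn hm, hl, ENNReal.toReal_ofReal]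
    positivity

/-! ### Coverage probability of the typical link -/

namespace SharedNetwork.IsModel

open RandomSource

variable {M : ℕ} {Ω : Type*} [MeasurableSpace Ω] {P : Measure Ω}
  {p : NetworkParams M} {S : SharedNetwork M Ω}

lemma ae_X0_ne_zero (hS : S.IsModel p P) (hp : p.Valid) : ∀ᵐ ω ∂P, S.X0 ω ≠ 0 := by
  have := map_smul_stdGaussian_singleton hp.δ_pos 0
  rw [← hS.X0_law, Measure.map_apply hS.X0_measurable (measurableSet_singleton _)] at this
  exact measure_eq_zero_iff_ae_notMem.1 this

variable [IsProbabilityMeasure P]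

lemma ae_XD_ne_X0 (hS : S.IsModel p P) (hp : p.Valid) (i : Fin M) (n : ℕ) :
    ∀ᵐ ω ∂P, S.XD i n ω ≠ S.X0 ω := by
  have hX := (hS.XD_ppp i).measurable n
  have hind : IndepFun (S.XD i n) S.X0 P :=
    hS.indepFun (A := {posD i}) (B := {typicalPos}) (by simp)
      (S.measurable_sigmaOf (Set.mem_singleton _) (S.measurable_XD i n))
      (S.measurable_sigmaOf (Set.mem_singleton _) (comap_measurable _))
  have hD : MeasurableSet {z : Plane × Plane | z.1 = z.2} :=
    measurableSet_eq_fun measurable_fst measurable_snd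
  have h := IndepFun.lintegral_comp_prodMk hX hS.X0_measurable hind
    (f := {z : Plane × Plane | z.1 = z.2}.indicator 1) (measurable_one.indicator hD)
  have h0 : ∀ ω, ∫⁻ ω', {z : Plane × Plane | z.1 = z.2}.indicator 1 (S.XD i n ω, S.X0 ω') ∂P =
      (0 : ℝ≥0∞) := by
    intro ω
    rw [← map_smul_stdGaussian_singleton hp.δ_pos (S.XD i n ω), ← hS.X0_law,
      Measure.map_apply hS.X0_measurable (measurableSet_singleton _),
      ← lintegral_indicator_one (hS.X0_measurable (measurableSet_singleton _))]
    refine lintegral_congr fun ω' => ?_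
    by_cases hx : S.XD i n ω = S.X0 ω'
    · rw [Set.indicator_of_mem (by exact hx), Set.indicator_of_mem (by exact hx.symm)]
      rfl
    · rw [Set.indicator_of_notMem (by exact hx),
        Set.indicator_of_notMem (by exact fun h => hx h.symm)]
  simp only [h0, lintegral_zero] at h
  have h' := (lintegral_eq_zero_iff ((measurable_one.indicator hD).comp
    (hX.prodMk hS.X0_measurable))).1 h
  filter_upwards [h'] with ω hω heq
  simp [heq] at hω

/-- Excluding the typical transmitter makes `interferenceD` depend on `X0`. Almost surely nothing is
excluded, and `totalNoiseD` involves only the D2D sources, so it is independent of `X0`. -/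
lemma interferenceD_ae_eq (hS : S.IsModel p P) (hp : p.Valid) :
    S.interferenceD p =ᵐ[P] S.totalNoiseD p := by
  have h : ∀ᵐ ω ∂P, ∀ i n, S.XD i n ω ≠ S.X0 ω :=
    ae_all_iff.2 fun i => ae_all_iff.2 fun n => hS.ae_XD_ne_X0 hp i n
  filter_upwards [h] with ω hω
  refine sum_congr rfl fun i _ => tsum_congr fun n => ?_
  simp only [Set.indicator_apply, interferersD, Set.mem_ofPred_eq, onD, Bool.and_eq_true, hω i n,
    ne_eq, not_false_eq_true, and_true]

/-- Conditioning on everything but the fading of the typical link. -/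
lemma measure_lt_sinrD (hS : S.IsModel p P) (hp : p.Valid) {β : ℝ} (hβ : 0 < β) :
    P {ω | ENNReal.ofReal β < S.sinrD p ω} =
      ∫⁻ ω, negExp (ENNReal.ofReal (β * p.PD⁻¹ * ‖S.X0 ω‖ ^ p.α) *
        (S.totalNoiseD p ω + S.interferenceB p ω + ENNReal.ofReal p.noise)) ∂P := by
  have hPD := hp.PD_pos
  -- `Z` is the threshold that `h0` has to exceed; it uses every source except `typicalFading`.
  set Z : Ω → ℝ≥0∞ := fun ω => ENNReal.ofReal (β * p.PD⁻¹ * ‖S.X0 ω‖ ^ p.α) *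
    (S.totalNoiseD p ω + S.interferenceB p ω + ENNReal.ofReal p.noise) with hZ
  have hZA : Measurable[S.sigmaOf {typicalFading}ᶜ] Z := by
    have h1 : Measurable[S.sigmaOf {typicalFading}ᶜ] S.X0 :=
      S.measurable_sigmaOf (l := typicalPos) (by simp) (comap_measurable _)
    have h2 := S.measurable_totalNoiseD p (A := {typicalFading}ᶜ) fun i => by
      simp [groupD, markD]
    have h3 := S.measurable_interferenceB p (A := {typicalFading}ᶜ) (by simp [groupB, markB])
    have h4 : Measurable fun z : Plane × ℝ≥0∞ × ℝ≥0∞ =>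
        ENNReal.ofReal (β * p.PD⁻¹ * ‖z.1‖ ^ p.α) *
          (z.2.1 + z.2.2 + ENNReal.ofReal p.noise) := by fun_prop
    have h5 := h4.comp (h1.prodMk (h2.prodMk h3))
    exact h5
  have hZm : Measurable Z := hS.measurable_of_sigmaOf hZA
  have hset : {ω | ENNReal.ofReal β < S.sinrD p ω} =ᵐ[P] {ω | Z ω < ENNReal.ofReal (S.h0 ω)} := by
    filter_upwards [hS.interferenceD_ae_eq hp, hS.ae_X0_ne_zero hp] with ω hω hX
    have hr : 0 < ‖S.X0 ω‖ := norm_pos_iff.2 hX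
    have hrα : 0 < ‖S.X0 ω‖ ^ p.α := by positivity
    have hβ' : ENNReal.ofReal β ≠ 0 := by simpa using hβ
    refine propext ?_
    change ENNReal.ofReal β < S.sinrD p ω ↔ Z ω < ENNReal.ofReal (S.h0 ω)
    -- As `β` is neither `0` nor `∞`, clearing the denominator is valid even when the denominator is
    -- `0` or `∞`.
    rw [sinrD, ENNReal.lt_div_iff_mul_lt (Or.inr ENNReal.ofReal_ne_top) (Or.inr hβ'), hω,
      receivedPower, ENNReal.ofReal_rpow_of_pos hr]
    have hk0 : ENNReal.ofReal (p.PD⁻¹ * ‖S.X0 ω‖ ^ p.α) ≠ 0 := by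
      rw [ne_eq, ENNReal.ofReal_eq_zero, not_le]; positivity
    rw [← ENNReal.mul_lt_mul_iff_right hk0 ENNReal.ofReal_ne_top]
    have e1 : ENNReal.ofReal (p.PD⁻¹ * ‖S.X0 ω‖ ^ p.α) * (ENNReal.ofReal β *
        (S.totalNoiseD p ω + S.interferenceB p ω + ENNReal.ofReal p.noise)) = Z ω := by
      rw [hZ, ← mul_assoc, ← ENNReal.ofReal_mul (by positivity)]
      ring_nf
    have e2 : ENNReal.ofReal (p.PD⁻¹ * ‖S.X0 ω‖ ^ p.α) * (ENNReal.ofReal (p.PD * S.h0 ω) *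
        ENNReal.ofReal (‖S.X0 ω‖ ^ (-p.α))) = ENNReal.ofReal (S.h0 ω) := by
      rw [mul_comm (ENNReal.ofReal (p.PD * S.h0 ω)), ← mul_assoc,
        ← ENNReal.ofReal_mul (by positivity), ← ENNReal.ofReal_mul (by positivity)]
      congr 1
      rw [Real.rpow_neg hr.le]
      field_simp
    rw [e1, e2]
  rw [measure_congr hset]
  have hind : IndepFun Z S.h0 P := hS.indepFun (disjoint_compl_left) hZA
    (S.measurable_sigmaOf (Set.mem_singleton typicalFading) (comap_measurable _))
  have hD : MeasurableSet {z : ℝ≥0∞ × ℝ | z.1 < ENNReal.ofReal z.2} :=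
    measurableSet_lt measurable_fst (by fun_prop)
  have h := IndepFun.lintegral_comp_prodMk hZm hS.h0_measurable hind
    (f := {z : ℝ≥0∞ × ℝ | z.1 < ENNReal.ofReal z.2}.indicator 1) (measurable_one.indicator hD)
  have hE : MeasurableSet {ω | Z ω < ENNReal.ofReal (S.h0 ω)} :=
    measurableSet_lt hZm hS.h0_measurable.ennreal_ofReal
  rw [← lintegral_indicator_one hE]
  refine h.trans (lintegral_congr fun ω => ?_)
  have hF : MeasurableSet {x | Z ω < ENNReal.ofReal x} :=
    measurableSet_lt measurable_const ENNReal.measurable_ofReal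
  -- For frozen `Z` the inner integral is the exponential tail at `Z ω`.
  rw [← expMeasure_one_setOf_lt_ofReal, ← hS.h0_law, Measure.map_apply hS.h0_measurable hF,
    ← lintegral_indicator_one (hS.h0_measurable hF)]
  rfl

lemma ae_totalNoiseD_lt_top (hS : S.IsModel p P) (hp : p.Valid) :
    ∀ᵐ ω ∂P, S.totalNoiseD p ω < ∞ :=
  ae_lt_top_of_lintegral_negExp hS.measurable_totalNoiseD
    (div_pos two_pos (two_pos.trans hp.two_lt_α)) fun _ ht =>
      hS.lintegral_negExp_totalNoiseD hp ht

lemma ae_interferenceB_lt_top (hS : S.IsModel p P) (hp : p.Valid) :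
    ∀ᵐ ω ∂P, S.interferenceB p ω < ∞ :=
  ae_lt_top_of_lintegral_negExp hS.measurable_interferenceB
    (div_pos two_pos (two_pos.trans hp.two_lt_α)) fun _ ht =>
      hS.lintegral_negExp_interferenceB hp ht

lemma laplaceTransform_totalNoiseD (hS : S.IsModel p P) (hp : p.Valid) {s : ℝ} (hs : 0 ≤ s) :
    laplaceTransform P (S.totalNoiseD p) s =
      Real.exp (-(p.lamDTilde * ((2 * Real.pi ^ 2 / p.α) / Real.sin (2 * Real.pi / p.α)) *
        (s * p.PD) ^ (2 / p.α))) :=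
  laplaceTransform_eq_of_lintegral_negExp hS.measurable_totalNoiseD
    (div_pos two_pos (two_pos.trans hp.two_lt_α))
    (fun _ ht => hS.lintegral_negExp_totalNoiseD hp ht) hs

lemma laplaceTransform_interferenceB (hS : S.IsModel p P) (hp : p.Valid) {s : ℝ} (hs : 0 ≤ s) :
    laplaceTransform P (S.interferenceB p) s =
      Real.exp (-(p.lamB * p.rhoS * ((2 * Real.pi ^ 2 / p.α) / Real.sin (2 * Real.pi / p.α)) *
        (s * p.PB) ^ (2 / p.α))) :=
  laplaceTransform_eq_of_lintegral_negExp hS.measurable_interferenceB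
    (div_pos two_pos (two_pos.trans hp.two_lt_α))
    (fun _ ht => hS.lintegral_negExp_interferenceB hp ht) hs

lemma laplaceTransform_interferenceD (hS : S.IsModel p P) (hp : p.Valid) (s : ℝ) :
    laplaceTransform P (S.interferenceD p) s = laplaceTransform P (S.totalNoiseD p) s :=
  integral_congr_ae ((hS.interferenceD_ae_eq hp).mono fun ω h => by simp only [h])

lemma lintegral_negExp_add (hS : S.IsModel p P) (hp : p.Valid) {s : ℝ} (hs : 0 ≤ s) :
    ∫⁻ ω, negExp (ENNReal.ofReal s *
        (S.totalNoiseD p ω + S.interferenceB p ω + ENNReal.ofReal p.noise)) ∂P =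
      ENNReal.ofReal (Real.exp (-s * p.noise) * laplaceTransform P (S.totalNoiseD p) s *
        laplaceTransform P (S.interferenceB p) s) := by
  have hm : Measurable fun x => negExp (ENNReal.ofReal s * x) := by fun_prop
  have hind : IndepFun (S.totalNoiseD p) (S.interferenceB p) P :=
    hS.indepFun (A := ⋃ i, groupD i) (B := groupB)
      (Set.disjoint_iUnion_left.2 disjoint_groupD_groupB)
      (S.measurable_totalNoiseD p (Set.subset_iUnion _)) (S.measurable_interferenceB p subset_rfl)
  have h := lintegral_mul_eq_lintegral_mul_lintegral_of_indepFun
    (hm.comp hS.measurable_totalNoiseD) (hm.comp hS.measurable_interferenceB) (hind.comp hm hm)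
  simp only [Pi.mul_apply, Function.comp_apply] at h
  simp only [mul_add, negExp_add]
  have hmI : Measurable fun ω => negExp (ENNReal.ofReal s * S.totalNoiseD p ω) *
      negExp (ENNReal.ofReal s * S.interferenceB p ω) :=
    (hm.comp hS.measurable_totalNoiseD).mul (hm.comp hS.measurable_interferenceB)
  rw [lintegral_mul_const _ hmI, h,
    ← ofReal_laplaceTransform hS.measurable_totalNoiseD (hS.ae_totalNoiseD_lt_top hp) hs,
    ← ofReal_laplaceTransform hS.measurable_interferenceB (hS.ae_interferenceB_lt_top hp) hs,
    ← ENNReal.ofReal_mul hs, negExp_ofReal (mul_nonneg hs hp.noise_nonneg),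
    ← ENNReal.ofReal_mul (laplaceTransform_nonneg _ _ _), ← ENNReal.ofReal_mul
      (mul_nonneg (laplaceTransform_nonneg _ _ _) (laplaceTransform_nonneg _ _ _))]
  congr 1
  rw [neg_mul]
  ring

/-- Interference and noise do not involve `X0`, so averaging them with `X0` frozen leaves a function
of `‖X0‖` alone, which is integrated against the Rayleigh density. -/
lemma measure_lt_sinrD_eq_lintegral (hS : S.IsModel p P) (hp : p.Valid) {β : ℝ} (hβ : 0 < β) :
    P {ω | ENNReal.ofReal β < S.sinrD p ω} =
      ∫⁻ v in Set.Ioi (0 : ℝ), ENNReal.ofReal (Real.exp (-(β * p.PD⁻¹ * v ^ p.α) * p.noise) *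
        laplaceTransform P (S.interferenceD p) (β * p.PD⁻¹ * v ^ p.α) *
        laplaceTransform P (S.interferenceB p) (β * p.PD⁻¹ * v ^ p.α) *
        rayleighDensity p.δ v) := by
  have hPD := hp.PD_pos
  have hδ := hp.δ_pos
  set W : Ω → ℝ≥0∞ := fun ω => S.totalNoiseD p ω + S.interferenceB p ω + ENNReal.ofReal p.noise
    with hW
  have hWA : Measurable[S.sigmaOf {typicalPos}ᶜ] W := by
    have h2 := S.measurable_totalNoiseD p (A := {typicalPos}ᶜ) fun i => by
      simp [groupD, markD]
    have h3 := S.measurable_interferenceB p (A := {typicalPos}ᶜ) (by simp [groupB, markB])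
    have h4 : Measurable fun z : ℝ≥0∞ × ℝ≥0∞ => z.1 + z.2 + ENNReal.ofReal p.noise := by fun_prop
    exact h4.comp (h2.prodMk h3)
  have hind : IndepFun S.X0 W P := hS.indepFun disjoint_compl_right
    (S.measurable_sigmaOf (Set.mem_singleton typicalPos) (comap_measurable _)) hWA
  have hWm : Measurable W := hS.measurable_of_sigmaOf hWA
  have h := IndepFun.lintegral_comp_prodMk hS.X0_measurable hWm hind
    (f := fun z => negExp (ENNReal.ofReal (β * p.PD⁻¹ * ‖z.1‖ ^ p.α) * z.2)) (by fun_prop)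
  rw [hS.measure_lt_sinrD hp hβ]
  refine h.trans ?_
  have hG : Measurable fun v : ℝ =>
      ∫⁻ ω, negExp (ENNReal.ofReal (β * p.PD⁻¹ * v ^ p.α) * W ω) ∂P :=
    Measurable.lintegral_prod_right' (f := fun z : ℝ × Ω =>
      negExp (ENNReal.ofReal (β * p.PD⁻¹ * z.1 ^ p.α) * W z.2)) (by fun_prop)
  have hR := lintegral_norm_map_smul_stdGaussian hδ hG
  have hGn : Measurable fun x : Plane =>
      ∫⁻ ω, negExp (ENNReal.ofReal (β * p.PD⁻¹ * ‖x‖ ^ p.α) * W ω) ∂P := hG.comp measurable_norm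
  rw [← hS.X0_law, lintegral_map hGn hS.X0_measurable] at hR
  refine hR.trans (setLIntegral_congr_fun measurableSet_Ioi fun v (hv : 0 < v) => ?_)
  have hray : 0 ≤ rayleighDensity p.δ v := by unfold rayleighDensity; positivity
  simp only [hW]
  rw [hS.lintegral_negExp_add hp (by positivity), ← ENNReal.ofReal_mul hray,
    hS.laplaceTransform_interferenceD hp, mul_comm (rayleighDensity p.δ v)]

/-- Integrability needs no estimate: the integrand is nonnegative and its lower integral is a
probability. -/
lemma integrableOn_coverage_integrand (hS : S.IsModel p P) (hp : p.Valid) {β : ℝ} (hβ : 0 < β) :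
    IntegrableOn
      (fun v : ℝ => Real.exp (-(β * p.PD⁻¹ * v ^ p.α) * p.noise) *
        laplaceTransform P (S.interferenceD p) (β * p.PD⁻¹ * v ^ p.α) *
        laplaceTransform P (S.interferenceB p) (β * p.PD⁻¹ * v ^ p.α) *
        rayleighDensity p.δ v) (Set.Ioi 0) ∧
    S.coverageD p P β =
      ∫ v in Set.Ioi (0 : ℝ), Real.exp (-(β * p.PD⁻¹ * v ^ p.α) * p.noise) *
        laplaceTransform P (S.interferenceD p) (β * p.PD⁻¹ * v ^ p.α) *
        laplaceTransform P (S.interferenceB p) (β * p.PD⁻¹ * v ^ p.α) *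
        rayleighDensity p.δ v := by
  have hPD := hp.PD_pos
  have hδ := hp.δ_pos
  have hl := hS.measure_lt_sinrD_eq_lintegral hp hβ
  set F : ℝ → ℝ := fun v => Real.exp (-(β * p.PD⁻¹ * v ^ p.α) * p.noise) *
        laplaceTransform P (S.interferenceD p) (β * p.PD⁻¹ * v ^ p.α) *
        laplaceTransform P (S.interferenceB p) (β * p.PD⁻¹ * v ^ p.α) *
        rayleighDensity p.δ v with hF
  have hm : AEStronglyMeasurable F (volume.restrict (Set.Ioi 0)) := by
    -- Measurability in `v` is read off the closed forms of the transforms, valid for `v > 0`.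
    refine AEStronglyMeasurable.congr (f := fun v : ℝ =>
      Real.exp (-(β * p.PD⁻¹ * v ^ p.α) * p.noise) *
      Real.exp (-(p.lamDTilde * ((2 * Real.pi ^ 2 / p.α) / Real.sin (2 * Real.pi / p.α)) *
        ((β * p.PD⁻¹ * v ^ p.α) * p.PD) ^ (2 / p.α))) *
      Real.exp (-(p.lamB * p.rhoS * ((2 * Real.pi ^ 2 / p.α) / Real.sin (2 * Real.pi / p.α)) *
        ((β * p.PD⁻¹ * v ^ p.α) * p.PB) ^ (2 / p.α))) * rayleighDensity p.δ v)
      (Measurable.aestronglyMeasurable (by unfold rayleighDensity; fun_prop)) ?_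
    filter_upwards [ae_restrict_mem measurableSet_Ioi] with v (hv : 0 < v)
    have hs : 0 ≤ β * p.PD⁻¹ * v ^ p.α := by positivity
    simp only [hF]
    rw [hS.laplaceTransform_interferenceD hp, hS.laplaceTransform_totalNoiseD hp hs,
      hS.laplaceTransform_interferenceB hp hs]
  have hnn : 0 ≤ᵐ[volume.restrict (Set.Ioi 0)] F := by
    filter_upwards [ae_restrict_mem measurableSet_Ioi] with v (hv : 0 < v)
    have hray : 0 ≤ rayleighDensity p.δ v := by unfold rayleighDensity; positivity
    exact mul_nonneg (mul_nonneg (mul_nonneg (Real.exp_pos _).le (laplaceTransform_nonneg _ _ _))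
      (laplaceTransform_nonneg _ _ _)) hray
  refine ⟨⟨hm, ?_⟩, ?_⟩
  · rw [hasFiniteIntegral_iff_ofReal hnn, ← hl]
    exact measure_lt_top _ _
  · rw [coverageD, integral_eq_lintegral_of_nonneg_ae hnn hm, ← hl]
    rfl

/-- With `c = β⁻¹ P_D / P_B` one has `s P_B = v^α c⁻¹`, whose power `2/α` is `v² c^(-2/α)`; the
remaining constant is `2π` times that of `H0`. -/
lemma laplaceTransform_interferenceB_eq_H0 (hS : S.IsModel p P) (hp : p.Valid) {β : ℝ}
    (hβ : 0 < β) {v : ℝ} (hv : 0 ≤ v) :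
    laplaceTransform P (S.interferenceB p) (β * p.PD⁻¹ * v ^ p.α) =
      Real.exp (-2 * Real.pi * p.rhoS * p.lamB * v ^ 2 * p.H0 β) := by
  have hPD := hp.PD_pos
  have hPB := hp.PB_pos
  have hα0 : 0 < p.α := two_pos.trans hp.two_lt_α
  have hc : 0 < β⁻¹ * (p.PD / p.PB) := by positivity
  rw [hS.laplaceTransform_interferenceB hp (by positivity), (hp.H0_eq hβ).2]
  have e : (β * p.PD⁻¹ * v ^ p.α) * p.PB = v ^ p.α * (β⁻¹ * (p.PD / p.PB))⁻¹ := by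
    field_simp
  rw [e, Real.mul_rpow (by positivity) (by positivity), ← Real.rpow_mul hv,
    mul_div_cancel₀ _ hα0.ne', Real.rpow_two, Real.inv_rpow hc.le, ← Real.rpow_neg hc.le]
  congr 1
  ring

end SharedNetwork.IsModel

end

theorem mainTheorem1 {M : ℕ} {Ω : Type*} [MeasurableSpace Ω] (P : Measure Ω)
    [IsProbabilityMeasure P] (p : NetworkParams M) (hp : p.Valid) (S : SharedNetwork M Ω)
    (hS : S.IsModel p P) (β : ℝ) (hβ : 0 < β) :
    (∀ᵐ ω ∂P, S.interferenceD p ω < ∞) ∧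
    (∀ᵐ ω ∂P, S.interferenceB p ω < ∞) ∧
    IntegrableOn
      (fun v : ℝ => Real.exp (-(β * p.PD⁻¹ * v ^ p.α) * p.noise) *
        laplaceTransform P (S.interferenceD p) (β * p.PD⁻¹ * v ^ p.α) *
        laplaceTransform P (S.interferenceB p) (β * p.PD⁻¹ * v ^ p.α) *
        rayleighDensity p.δ v) (Set.Ioi 0) ∧
    S.coverageD p P β =
      ∫ v in Set.Ioi (0 : ℝ), Real.exp (-(β * p.PD⁻¹ * v ^ p.α) * p.noise) *
        laplaceTransform P (S.interferenceD p) (β * p.PD⁻¹ * v ^ p.α) *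
        laplaceTransform P (S.interferenceB p) (β * p.PD⁻¹ * v ^ p.α) *
        rayleighDensity p.δ v ∧
    (∀ s : ℝ, 0 ≤ s → laplaceTransform P (S.interferenceD p) s =
      Real.exp (-p.lamDTilde * ((2 * Real.pi ^ 2 / p.α) / Real.sin (2 * Real.pi / p.α)) *
        (s * p.PD) ^ (2 / p.α))) ∧
    IntegrableOn (fun x : ℝ => x / (1 + β⁻¹ * (p.PD / p.PB) * x ^ p.α)) (Set.Ioi 0) ∧
    (∀ v : ℝ, 0 ≤ v → laplaceTransform P (S.interferenceB p) (β * p.PD⁻¹ * v ^ p.α) =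
      Real.exp (-2 * Real.pi * p.rhoS * p.lamB * v ^ 2 * p.H0 β)) := by
  refine ⟨?_, hS.ae_interferenceB_lt_top hp, (hS.integrableOn_coverage_integrand hp hβ).1,
    (hS.integrableOn_coverage_integrand hp hβ).2, fun s hs => ?_, (hp.H0_eq hβ).1,
    fun v hv => hS.laplaceTransform_interferenceB_eq_H0 hp hβ hv⟩
  · filter_upwards [hS.interferenceD_ae_eq hp, hS.ae_totalNoiseD_lt_top hp] with ω h1 h2
    rwa [h1]
  · rw [hS.laplaceTransform_interferenceD hp, hS.laplaceTransform_totalNoiseD hp hs]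
    simp only [neg_mul]
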